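/- Let $k\ge 0$ and let $\mathcal S\subseteq\mathbb R_+^k$ be a subsemigroup containing $0$ such that for every $r$ in the group $\mathcal S-\mathcal S$ both $r_+=(\max\{r_1,0\},\dots,\max\{r_k,0\})$ and $r_-=r_+-r$ belong to $\mathcal S$. Let $\mathcal A$ be a unital $C^*$-algebra. A unital correspondence over $\mathcal A$ is a (right) Hilbert $C^*$-module $E$ over $\mathcal A$ with a left action of $\mathcal A$ given by a unital $*$-homomorphism into the adjointable operators on $E$. A product system $X=\{X(s)\}_{s\in\mathcal S}$ of such correspondences consists of correspondences $X(s)$ with $X(0)=\mathcal A$ and an associative multiplication $X(s)\times X(t)\to X(s+t)$, given by the left and right actions of $\mathcal A$ when $s=0$ or $t=0$, which induces unitary correspondence maps $X(s)\otimes_{\mathcal A}X(t)\to X(s+t)$. If $\mathcal A$ is a $W^*$-algebra, $X$ is a product system of $W^*$-correspondences if each $X(s)$ is self-dual with normal left action, and $X(s)\otimes_{\mathcal A}X(t)$ is understood as the self-dual extension of the interior tensor product. A representation $(\sigma,T)$ of $X$ on a Hilbert space $H$ consists of a nondegenerate $*$-homomorphism $\sigma:\mathcal A\to B(H)$ and completely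 bounded linear maps $T_s:X(s)\to B(H)$ with $T_0=\sigma$, $T_s(axb)=\sigma(a)T_s(x)\sigma(b)$ and $T_{s+t}(xy)=T_s(x)T_t(y)$. It is isometric if $T_s(x)^*T_s(y)=\sigma(\langle x,y\rangle)$ for all $s\in\mathcal S$ and $x,y\in X(s)$, and fully coisometric if for every $s\in\mathcal S$ the map $x\otimes h\mapsto T_s(x)h$ extends to a coisometry $\widetilde T_s:X(s)\otimes_\sigma H\to H$. It is a representation of $W^*$-correspondences if, in addition, $\sigma$ is normal. Let $X$ be a product system of unital $\mathcal A$-correspondences over $\mathcal S$, and let $(\sigma,T)$ be a fully coisometric representation of $X$ on $H$ with $\sigma$ unital. Then there exist a Hilbert space $K\supseteq H$ and an isometric and fully coisometric representation $(\rho,V)$ of $X$ on $K$, with $\rho$ unital (in particular nondegenerate), which is minimal, i.e. $K$ is the closed linear span of $\{V_s(x)h: s\in\mathcal S,\ x\in X(s),\ h\in H\}$, and such that, $P_H$ denoting the orthogonal projection of $K$ onto $H$, 1. $P_H$ commutes with $\rho(\mathcal A)$, and $\rho(a)P_H=\sigma(a)P_H$ for all $a\in\mathcal A$; 2. $P_HV_s(x)|_H=T_s(x)$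 for all $s\in\mathcal S$, $x\in X(s)$; 3. $P_HV_s(x)|_{K\ominus H}=0$ for all $s\in\mathcal S$, $x\in X(s)$. If $\mathcal A$ is a $W^*$-algebra, $X$ is a product system of unital $W^*$-correspondences and $(\sigma,T)$ is a fully coisometric representation of $W^*$-correspondences with $\sigma$ unital, then the same conclusion holds with $(\rho,V)$ a representation of $W^*$-correspondences, i.e. with $\rho$ normal. -/

import Mathlib

open scoped TensorProduct ComplexOrder RightActions

universe u v w

/-! ### Normality -/

/-- `f` preserves suprema of increasing (upward directed) bounded nets of self-adjoint elements.
For a positive linear functional on a W*-algebra this is normality, i.e. weak-* continuity. -/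
def PreservesDirectedSups {A B : Type*} [Star A] [Preorder A] [Preorder B] (f : A → B) : Prop :=
  ∀ D : Set A, (∀ d ∈ D, IsSelfAdjoint d) → D.Nonempty → DirectedOn (· ≤ ·) D →
    ∀ a : A, IsLUB D a → IsLUB (f '' D) (f a)

/-- A normal positive linear functional. -/
def IsNormalPositiveFunctional {A : Type u} [CStarAlgebra A] [PartialOrder A]
    (ω : A →ₗ[ℂ] ℂ) : Prop :=
  (∀ a : A, 0 ≤ a → 0 ≤ ω a) ∧ PreservesDirectedSups ω

/-- A `*`-homomorphism into `B(H)` is normal: all the functionals `a ↦ ⟪h, σ(a) h⟫` are normal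
(this is continuity from the weak-* topology to the σ-weak topology of `B(H)`). -/
def IsNormalRep {A : Type u} [CStarAlgebra A] [PartialOrder A] {H : Type w}
    [NormedAddCommGroup H] [InnerProductSpace ℂ H] [CompleteSpace H]
    (σ : A →⋆ₙₐ[ℂ] (H →L[ℂ] H)) : Prop :=
  ∀ h : H, PreservesDirectedSups fun a : A => inner ℂ h (σ a h)

/-! ### Correspondences -/

/-- A unital `C*`-correspondence over a unital `C*`-algebra `A`: a (right) Hilbert `C*`-module over
`A` together with a unital `*`-homomorphism of `A` into the adjointable operators, written as a
left action. The right action is `x <• a`; the inner product is linear in the second variable.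
(Mathlib's `CStarModule` is the notion of a *left* Hilbert module, so it is not used here.) -/
structure CStarCorr (A : Type u) [CStarAlgebra A] [PartialOrder A] [StarOrderedRing A] where
  carrier : Type v
  [normedAddCommGroup : NormedAddCommGroup carrier]
  [normedSpace : NormedSpace ℂ carrier]
  [completeSpace : CompleteSpace carrier]
  /-- the left action; the axioms of a module contain `1 • x = x` -/
  [leftModule : Module A carrier]
  [rightModule : Module Aᵐᵒᵖ carrier]
  /-- the `A`-valued inner product -/
  ip : carrier → carrier → A
  ip_add_right : ∀ x y z, ip x (y + z) = ip x y + ip x z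
  ip_smul_right : ∀ (c : ℂ) (x y), ip x (c • y) = c • ip x y
  ip_op_smul_right : ∀ (a : A) (x y), ip x (y <• a) = ip x y * a
  star_ip : ∀ x y, star (ip x y) = ip y x
  ip_self_nonneg : ∀ x, 0 ≤ ip x x
  norm_eq : ∀ x, ‖x‖ = √‖ip x x‖
  smul_op_smul : ∀ (c : ℂ) (a : A) (x : carrier), c • (x <• a) = (c • x) <• a
  op_smul_smul : ∀ (c : ℂ) (a : A) (x : carrier), x <• (c • a) = c • (x <• a)
  /-- the left action of `a` is adjointable, with adjoint the left action of `star a` -/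
  ip_left_smul : ∀ (a : A) (x y), ip (a • x) y = ip x (star a • y)
  smul_left_smul : ∀ (c : ℂ) (a : A) (x : carrier), (c • a) • x = c • (a • x)

namespace CStarCorr

instance {A : Type u} [CStarAlgebra A] [PartialOrder A] [StarOrderedRing A] :
    CoeSort (CStarCorr.{u, v} A) (Type v) := ⟨CStarCorr.carrier⟩

attribute [instance] normedAddCommGroup normedSpace completeSpace leftModule rightModule

variable {A : Type u} [CStarAlgebra A] [PartialOrder A] [StarOrderedRing A]

/-- Self-duality: every bounded (right) `A`-linear map `E → A` is `⟨y, ·⟩` for some `y ∈ E`. -/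
def IsSelfDual (E : CStarCorr.{u, v} A) : Prop :=
  ∀ f : E →L[ℂ] A, (∀ (x : E) (a : A), f (x <• a) = f x * a) → ∃ y : E, ∀ x : E, f x = E.ip y x

/-- Over a W*-algebra: `E` is a W*-correspondence, i.e. it is self-dual and its left action is
normal. (The predual of the W*-algebra of adjointable operators on `E` is generated by the
functionals `T ↦ ω(⟨x, T x⟩)` with `ω` in the predual of `A`, so normality of the left action
means normality of all the positive functionals `a ↦ ω(⟨x, a x⟩)`.) -/
def IsWStarCorr (E : CStarCorr.{u, v} A) : Prop :=
  E.IsSelfDual ∧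
    ∀ (x : E) (ω : A →ₗ[ℂ] ℂ), IsNormalPositiveFunctional ω →
      PreservesDirectedSups fun a : A => ω (E.ip x (a • x))

/-- Density for the topology given by the seminorms `x ↦ ω(⟨x, x⟩)^{1/2}`, `ω` a normal positive
functional on `A`. A W*-module is the self-dual extension of a (right) submodule `F` exactly when `F` is
dense in it in this sense. -/
def IsUltrastronglyDense (E : CStarCorr.{u, v} A) (F : Submodule ℂ E) : Prop :=
  ∀ (x : E) (ω : A →ₗ[ℂ] ℂ), IsNormalPositiveFunctional ω → ∀ ε : ℝ, 0 < ε →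
    ∃ y ∈ F, ‖ω (E.ip (x - y) (x - y))‖ < ε

/-! ### The Hilbert space `E ⊗_σ H` -/

section InteriorTensor

variable {H : Type w} [NormedAddCommGroup H] [InnerProductSpace ℂ H] [CompleteSpace H]

lemma ip_add_left (E : CStarCorr.{u, v} A) (x y z : E) :
    E.ip (x + y) z = E.ip x z + E.ip y z := by
  rw [← E.star_ip, E.ip_add_right, star_add, E.star_ip, E.star_ip]

lemma ip_smul_left (E : CStarCorr.{u, v} A) (c : ℂ) (x y : E) :
    E.ip (c • x) y = star c • E.ip x y := by
  rw [← E.star_ip, E.ip_smul_right, star_smul, E.star_ip]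

lemma ip_op_smul_left (E : CStarCorr.{u, v} A) (a : A) (x y : E) :
    E.ip (x <• a) y = star a * E.ip x y := by
  rw [← E.star_ip, E.ip_op_smul_right, star_mul, E.star_ip]

/-- `ip` as a sesquilinear map. -/
noncomputable def ipₛₗ (E : CStarCorr.{u, v} A) : E →ₗ⋆[ℂ] E →ₗ[ℂ] A :=
  LinearMap.mk₂'ₛₗ (starRingEnd ℂ) (RingHom.id ℂ) E.ip E.ip_add_left E.ip_smul_left
    E.ip_add_right E.ip_smul_right

lemma ip_sum_sum (E : CStarCorr.{u, v} A) {ι : Type*} [Fintype ι] (x : ι → E) (a : ι → A) :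
    E.ip (∑ i, x i <• a i) (∑ j, x j <• a j) =
      ∑ i, ∑ j, star (a i) * E.ip (x i) (x j) * a j := by
  change E.ipₛₗ _ _ = _
  simp only [map_sum, LinearMap.sum_apply]
  rw [Finset.sum_comm]
  refine Finset.sum_congr rfl fun i _ => Finset.sum_congr rfl fun j _ => ?_
  change E.ip _ _ = _
  rw [E.ip_op_smul_left, E.ip_op_smul_right, mul_assoc]


/-- The Gram matrix of a finite family of vectors. -/
def gram (E : CStarCorr.{u, v} A) {ι : Type*} (x : ι → E) : CStarMatrix ι ι A :=
  CStarMatrix.ofMatrix fun i j => E.ip (x i) (x j)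

lemma isSelfAdjoint_gram (E : CStarCorr.{u, v} A) {ι : Type*} (x : ι → E) :
    IsSelfAdjoint (E.gram x) := by
  ext i j
  exact E.star_ip _ _

/-- A criterion for positivity in a `C*`-algebra: no compression of `a` is nonzero and negative. -/
lemma eq_star_mul_self_of_compressions {B : Type*} [CStarAlgebra B] [PartialOrder B]
    [StarOrderedRing B] {a : B} (ha : IsSelfAdjoint a)
    (h : ∀ n m : B, star n * a * n = -(star m * m) → m = 0) : ∃ b : B, a = star b * b := by
  have hN0 : 0 ≤ a⁻ := CFC.negPart_nonneg a
  have hNsa : star a⁻ = a⁻ := (IsSelfAdjoint.of_nonneg hN0).star_eq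
  have hcube : star a⁻ * a * a⁻ = -(a⁻ * a⁻ * a⁻) := by
    have h1 : a⁻ * a = -(a⁻ * a⁻) := by
      nth_rewrite 2 [← CFC.posPart_sub_negPart a ha]
      rw [mul_sub, CFC.negPart_mul_posPart, zero_sub]
    rw [hNsa, h1, neg_mul]
  have hcube0 : 0 ≤ a⁻ * a⁻ * a⁻ := by
    have := star_left_conjugate_nonneg hN0 a⁻
    rwa [hNsa] at this
  obtain ⟨m, hm⟩ := CStarAlgebra.nonneg_iff_eq_star_mul_self.mp hcube0
  have hmz : m = 0 := h a⁻ m (by rw [hcube, hm])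
  have hN3 : a⁻ * a⁻ * a⁻ = 0 := by rw [hm, hmz, mul_zero]
  have hN2 : a⁻ * a⁻ = 0 := by
    have : star (a⁻ * a⁻) * (a⁻ * a⁻) = 0 := by
      rw [star_mul, hNsa, ← mul_assoc, hN3, zero_mul]
    exact (CStarRing.star_mul_self_eq_zero_iff _).mp this
  have hN : a⁻ = 0 := by
    have : star a⁻ * a⁻ = 0 := by rw [hNsa, hN2]
    exact (CStarRing.star_mul_self_eq_zero_iff _).mp this
  have := CFC.posPart_sub_negPart a ha
  rw [hN, sub_zero] at this
  have ha0 : 0 ≤ a := by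
    rw [← this]
    exact CFC.posPart_nonneg a
  exact CStarAlgebra.nonneg_iff_eq_star_mul_self.mp ha0

lemma gram_eq_star_mul_self (E : CStarCorr.{u, v} A) {ι : Type*} [Fintype ι] (x : ι → E) :
    ∃ M : CStarMatrix ι ι A, E.gram x = star M * M := by
  classical
  refine eq_star_mul_self_of_compressions (E.isSelfAdjoint_gram x) fun N M hNM => ?_
  have hdiag : ∀ i, 0 ≤ (star N * E.gram x * N) i i := by
    intro i
    have h := E.ip_self_nonneg (∑ k, x k <• N k i)
    rw [E.ip_sum_sum] at h
    convert h using 1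
    simp only [CStarMatrix.mul_apply, Finset.sum_mul]
    rw [Finset.sum_comm]
    rfl
  have hle : ∀ i, ∑ k, star (M k i) * M k i ≤ 0 := by
    intro i
    have h := hdiag i
    rw [hNM] at h
    have h' : (star M * M) i i = ∑ k, star (M k i) * M k i := by
      simp [CStarMatrix.mul_apply, CStarMatrix.star_apply]
    have h'' : (-(star M * M)) i i = -((star M * M) i i) := rfl
    rw [h'', h'] at h
    exact neg_nonneg.mp h
  ext k i
  have hz : ∑ k, star (M k i) * M k i = 0 :=
    le_antisymm (hle i) (Finset.sum_nonneg fun _ _ => star_mul_self_nonneg _)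
  have := (Finset.sum_eq_zero_iff_of_nonneg
    (fun k _ => star_mul_self_nonneg (M k i))).mp hz k (Finset.mem_univ k)
  exact (CStarRing.star_mul_self_eq_zero_iff _).mp this

/-- The algebraic tensor product of `E` and `H` over `ℂ`, to be endowed with the semi-inner product
`⟪x ⊗ h, y ⊗ g⟫ = ⟪h, σ(⟨x, y⟩) g⟫`. -/
@[nolint unusedArguments]
def PreTensor (E : CStarCorr.{u, v} A) (_σ : A →⋆ₙₐ[ℂ] (H →L[ℂ] H)) : Type (max v w) :=
  E ⊗[ℂ] H

section PreTensor

variable (E : CStarCorr.{u, v} A) (σ : A →⋆ₙₐ[ℂ] (H →L[ℂ] H))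

noncomputable instance : AddCommGroup (E.PreTensor σ) := inferInstanceAs (AddCommGroup (E ⊗[ℂ] H))

noncomputable instance : Module ℂ (E.PreTensor σ) := inferInstanceAs (Module ℂ (E ⊗[ℂ] H))

/-- `x ⊗ h` in the algebraic tensor product. -/
def preTmul (x : E) (h : H) : E.PreTensor σ := x ⊗ₜ[ℂ] h

/-- For fixed `x` and `h`, the functional `y ⊗ g ↦ ⟪h, σ(⟨x, y⟩) g⟫`. -/
noncomputable def preInnerAux (x : E) (h : H) : E ⊗[ℂ] H →ₗ[ℂ] ℂ :=
  TensorProduct.lift <| LinearMap.mk₂ ℂ (fun (y : E) (g : H) => inner ℂ h (σ (E.ip x y) g))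
    (by intros; simp [E.ip_add_right])
    (by intros; simp [E.ip_smul_right])
    (by intros; simp)
    (by intros; simp)

/-- The semi-inner product on the algebraic tensor product. -/
noncomputable def preInner : E ⊗[ℂ] H →ₗ⋆[ℂ] E ⊗[ℂ] H →ₗ[ℂ] ℂ :=
  TensorProduct.lift <| LinearMap.mk₂'ₛₗ (starRingEnd ℂ) (starRingEnd ℂ) (E.preInnerAux σ)
    (by intros; ext; simp [preInnerAux, E.ip_add_left])
    (by intros; ext; simp [preInnerAux, E.ip_smul_left])
    (by intros; ext; simp [preInnerAux])
    (by intros; ext; simp [preInnerAux, mul_comm])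

lemma preInner_tmul (x y : E) (h g : H) :
    E.preInner σ (x ⊗ₜ h) (y ⊗ₜ g) = inner ℂ h (σ (E.ip x y) g) := rfl

lemma preInner_conj_symm (a b : E ⊗[ℂ] H) :
    (starRingEnd ℂ) (E.preInner σ b a) = E.preInner σ a b := by
  induction a using TensorProduct.induction_on with
  | zero => simp
  | add a₁ a₂ h₁ h₂ => simp [h₁, h₂]
  | tmul x h =>
    induction b using TensorProduct.induction_on with
    | zero => simp
    | add b₁ b₂ h₁ h₂ => simp [h₁, h₂]
    | tmul y g =>
      rw [preInner_tmul, preInner_tmul, inner_conj_symm, ← E.star_ip x y, map_star,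
        ContinuousLinearMap.star_eq_adjoint, ContinuousLinearMap.adjoint_inner_left]

lemma preInner_self_nonneg (a : E ⊗[ℂ] H) : 0 ≤ (E.preInner σ a a).re := by
  obtain ⟨n, x, h, rfl⟩ : ∃ (n : ℕ) (x : Fin n → E) (h : Fin n → H), a = ∑ i, x i ⊗ₜ[ℂ] h i := by
    obtain ⟨S, rfl⟩ := TensorProduct.exists_finset a
    refine ⟨S.card, fun i => (S.equivFin.symm i).1.1, fun i => (S.equivFin.symm i).1.2, ?_⟩
    rw [← Finset.sum_coe_sort]
    exact (Equiv.sum_comp S.equivFin.symm (fun p => p.1.1 ⊗ₜ[ℂ] p.1.2)).symm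
  obtain ⟨M, hM⟩ := E.gram_eq_star_mul_self x
  have hG : ∀ i j, E.ip (x i) (x j) = ∑ k, star (M k i) * M k j := by
    intro i j
    have : E.gram x i j = (star M * M) i j := by rw [hM]
    simp only [CStarMatrix.mul_apply, CStarMatrix.star_apply] at this
    exact this
  have key : E.preInner σ (∑ i, x i ⊗ₜ[ℂ] h i) (∑ i, x i ⊗ₜ[ℂ] h i) =
      ∑ k, inner ℂ (∑ i, σ (M k i) (h i)) (∑ j, σ (M k j) (h j)) := by
    simp only [map_sum, LinearMap.sum_apply, preInner_tmul, hG, map_mul, map_star, inner_sum,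
      sum_inner, sum_apply, mul_apply_eq_comp,
      ContinuousLinearMap.star_eq_adjoint, ContinuousLinearMap.adjoint_inner_right]
    rw [Finset.sum_comm, Finset.sum_congr rfl fun j _ => Finset.sum_comm, Finset.sum_comm]
    exact Finset.sum_congr rfl fun k _ => Finset.sum_comm
  rw [key, Complex.re_sum]
  exact Finset.sum_nonneg fun k _ => inner_self_nonneg (𝕜 := ℂ)

/-- The semi-inner product `⟪x ⊗ h, y ⊗ g⟫ = ⟪h, σ(⟨x, y⟩) g⟫`. -/
@[reducible]
noncomputable def preCore : PreInnerProductSpace.Core ℂ (E.PreTensor σ) where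
  inner a b := E.preInner σ a b
  conj_inner_symm a b := E.preInner_conj_symm σ a b
  re_inner_nonneg a := E.preInner_self_nonneg σ a
  add_left a b c := by
    exact LinearMap.map_add₂ (E.preInner σ) a b c
  smul_left a b r := by
    exact LinearMap.map_smulₛₗ₂ (E.preInner σ) r a b

noncomputable instance : SeminormedAddCommGroup (E.PreTensor σ) :=
  InnerProductSpace.Core.toSeminormedAddCommGroup (𝕜 := ℂ) (c := E.preCore σ)

noncomputable instance : InnerProductSpace ℂ (E.PreTensor σ) :=
  InnerProductSpace.ofCore (E.preCore σ)

/-- The Hilbert space `E ⊗_σ H`: the Hausdorff completion of the algebraic tensor product for the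
semi-inner product `⟪x ⊗ h, y ⊗ g⟫ = ⟪h, σ(⟨x, y⟩) g⟫`. -/
abbrev InteriorTensor : Type (max v w) := UniformSpace.Completion (E.PreTensor σ)

/-- The elementary tensor `x ⊗ h` in `E ⊗_σ H`. -/
noncomputable def tmul (x : E) (h : H) : E.InteriorTensor σ :=
  (E.preTmul σ x h : UniformSpace.Completion (E.PreTensor σ))

/-- The inner product of elementary tensors. -/
lemma inner_tmul_tmul (x y : E) (h g : H) :
    inner ℂ (E.tmul σ x h) (E.tmul σ y g) = inner ℂ h (σ (E.ip x y) g) := by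
  rw [tmul, tmul, UniformSpace.Completion.inner_coe]
  rfl

end PreTensor

/-! ### Representations of a correspondence -/

section Representations

variable {E : CStarCorr.{u, v} A} (σ : A →⋆ₙₐ[ℂ] (H →L[ℂ] H)) (T : E →ₗ[ℂ] (H →L[ℂ] H))

/-- `T : E → B(H)` is completely bounded: all the maps `M_n(E) → M_n(B(H))`, `(x_ij) ↦ (T(x_ij))`,
are bounded by one constant. The norm of a matrix `(x_ij)` over `E` is that of the Hilbert module
`M_n(E)` over `M_n(A)`: the square root of the norm of the matrix with entries
`∑ k, ⟨x_ki, x_kj⟩`. -/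
def IsCompletelyBounded (T : E →ₗ[ℂ] (H →L[ℂ] H)) : Prop :=
  ∃ C : ℝ, ∀ (n : ℕ) (x : Fin n → Fin n → E),
    ‖(CStarMatrix.ofMatrix fun i j => T (x i j) : CStarMatrix (Fin n) (Fin n) (H →L[ℂ] H))‖ ≤
      C * √‖(CStarMatrix.ofMatrix fun i j => ∑ k, E.ip (x k i) (x k j) :
        CStarMatrix (Fin n) (Fin n) A)‖

/-- `(σ, T)` is a covariant representation of `E` on `H`. -/
structure IsCovariantRep : Prop where
  completelyBounded : IsCompletelyBounded T
  nondegenerate : (Submodule.span ℂ {y : H | ∃ a h, σ a h = y}).topologicalClosure = ⊤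
  map_op_smul : ∀ (x : E) (a : A), T (x <• a) = T x * σ a
  map_smul : ∀ (a : A) (x : E), T (a • x) = σ a * T x

/-- `(σ, T)` is isometric: `T(x)* T(y) = σ(⟨x, y⟩)`. -/
def IsIsometricRep : Prop :=
  ∀ x y : E, star (T x) * T y = σ (E.ip x y)

/-- `(σ, T)` is fully coisometric: the operator `T̃ : E ⊗_σ H → H`, `T̃(x ⊗ h) = T(x) h`, is a
(bounded, everywhere defined) coisometry. -/
def IsFullyCoisometricRep : Prop :=
  ∃ Tt : E.InteriorTensor σ →L[ℂ] H,
    (∀ x h, Tt (E.tmul σ x h) = T x h) ∧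
    Tt ∘L ContinuousLinearMap.adjoint Tt = ContinuousLinearMap.id ℂ H

end Representations

end InteriorTensor

end CStarCorr

/-! ### Product systems -/

/-- A bundle `X = {X(s)}` of unital correspondences over `A`, indexed by a commutative monoid `M`,
with `X(0) = A` (through the isomorphism `unit`) and with an associative multiplication
`X(s) × X(t) → X(s + t)` that induces isometric correspondence maps
`U_{s,t} : X(s) ⊗_A X(t) → X(s + t)`. The multiplication is indexed by proofs of `s + t = r`, so
that associativity can be stated without transport. -/
structure PreProductSystem (M : Type*) [AddCommMonoid M]
    (A : Type u) [CStarAlgebra A] [PartialOrder A] [StarOrderedRing A] where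
  fiber : M → CStarCorr.{u, v} A
  mul : ∀ {s t r : M}, s + t = r → fiber s →ₗ[ℂ] fiber t →ₗ[ℂ] fiber r
  /-- the inner product of `X(s) ⊗_A X(t)` is carried to that of `X(s + t)` -/
  ip_mul : ∀ {s t r : M} (e : s + t = r) (x x' : fiber s) (y y' : fiber t),
    (fiber r).ip (mul e x y) (mul e x' y') = (fiber t).ip y ((fiber s).ip x x' • y')
  smul_mul : ∀ {s t r : M} (e : s + t = r) (a : A) (x : fiber s) (y : fiber t),
    mul e (a • x) y = a • mul e x y
  mul_op_smul : ∀ {s t r : M} (e : s + t = r) (a : A) (x : fiber s) (y : fiber t),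
    mul e x (y <• a) = mul e x y <• a
  mul_assoc : ∀ {s t r st tr str : M} (e₁ : s + t = st) (e₂ : st + r = str) (e₃ : t + r = tr)
    (e₄ : s + tr = str) (x : fiber s) (y : fiber t) (z : fiber r),
    mul e₂ (mul e₁ x y) z = mul e₄ x (mul e₃ y z)
  /-- the identification of `A` with `X(0)` -/
  unit : A ≃ₗ[ℂ] fiber 0
  unit_mul_left : ∀ a b : A, unit (a * b) = a • unit b
  unit_mul_right : ∀ a b : A, unit (a * b) = unit a <• b
  ip_unit : ∀ a b : A, (fiber 0).ip (unit a) (unit b) = star a * b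
  unit_mul : ∀ {s : M} (e : 0 + s = s) (a : A) (x : fiber s), mul e (unit a) x = a • x
  mul_unit : ∀ {s : M} (e : s + 0 = s) (x : fiber s) (a : A), mul e x (unit a) = x <• a

namespace PreProductSystem

variable {M : Type*} [AddCommMonoid M] {A : Type u} [CStarAlgebra A] [PartialOrder A]
  [StarOrderedRing A]

/-- The range in `X(s + t)` of the algebraic tensor product of `X(s)` and `X(t)`. -/
def products (X : PreProductSystem.{u, v} M A) (s t : M) : Submodule ℂ (X.fiber (s + t)) :=
  Submodule.span ℂ {z | ∃ x y, X.mul rfl x y = z}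

/-- `X` is a product system of `C*`-correspondences: the isometric correspondence maps
`U_{s,t} : X(s) ⊗_A X(t) → X(s + t)` are onto, where `X(s) ⊗_A X(t)` is the norm completion of the
algebraic tensor product. -/
def IsProductSystem (X : PreProductSystem.{u, v} M A) : Prop :=
  ∀ s t : M, (X.products s t).topologicalClosure = ⊤

/-- `X` is a product system of `W*`-correspondences: the fibers are `W*`-correspondences and the
isometric correspondence maps `U_{s,t} : X(s) ⊗_A X(t) → X(s + t)` are onto, where
`X(s) ⊗_A X(t)` is the self-dual extension of the interior tensor product. -/
def IsWStarProductSystem (X : PreProductSystem.{u, v} M A) : Prop :=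
  (∀ s : M, (X.fiber s).IsWStarCorr) ∧
    ∀ s t : M, (X.fiber (s + t)).IsUltrastronglyDense (X.products s t)

/-- A covariant representation `(σ, T)` of `X` on `H`. -/
structure Representation (X : PreProductSystem.{u, v} M A)
    (H : Type w) [NormedAddCommGroup H] [InnerProductSpace ℂ H] [CompleteSpace H] where
  σ : A →⋆ₙₐ[ℂ] (H →L[ℂ] H)
  T : ∀ s : M, X.fiber s →ₗ[ℂ] (H →L[ℂ] H)
  isCovariantRep : ∀ s, CStarCorr.IsCovariantRep σ (T s)
  T_unit : ∀ a : A, T 0 (X.unit a) = σ a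
  map_mul : ∀ {s t r : M} (e : s + t = r) (x : X.fiber s) (y : X.fiber t),
    T r (X.mul e x y) = T s x * T t y

namespace Representation

variable {X : PreProductSystem.{u, v} M A}
  {H : Type w} [NormedAddCommGroup H] [InnerProductSpace ℂ H] [CompleteSpace H]

/-- Isometric on every fiber. -/
def IsIsometric (R : X.Representation H) : Prop :=
  ∀ s, CStarCorr.IsIsometricRep R.σ (R.T s)

/-- Fully coisometric on every fiber. -/
def IsFullyCoisometric (R : X.Representation H) : Prop :=
  ∀ s, CStarCorr.IsFullyCoisometricRep R.σ (R.T s)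

/-- The orthogonal projection `J J*` of `K` onto the range of the isometry `J : H → K`. -/
noncomputable def rangeProj {K : Type*} [NormedAddCommGroup K] [InnerProductSpace ℂ K]
    [CompleteSpace K] (J : H →ₗᵢ[ℂ] K) : K →L[ℂ] K :=
  J.toContinuousLinearMap ∘L ContinuousLinearMap.adjoint J.toContinuousLinearMap

/-- `V = (ρ, V)` on `K` is a minimal dilation of `R = (σ, T)` on `H`, where `H` is regarded as a
subspace of `K` through the isometry `J`; and `rangeProj J` is the orthogonal projection `P_H`. -/
structure IsMinimalDilation {K : Type*} [NormedAddCommGroup K] [InnerProductSpace ℂ K]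
    [CompleteSpace K] (R : X.Representation H) (V : X.Representation K) (J : H →ₗᵢ[ℂ] K) :
    Prop where
  /-- `P_H` commutes with `ρ(A)` -/
  commute : ∀ a : A, Commute (rangeProj J) (V.σ a)
  /-- `ρ(a) P_H = σ(a) P_H` -/
  extend : ∀ (a : A) (h : H), V.σ a (J h) = J (R.σ a h)
  /-- `P_H V_s(x)|_H = T_s(x)` -/
  compress : ∀ (s : M) (x : X.fiber s) (h : H),
    rangeProj J (V.T s x (J h)) = J (R.T s x h)
  /-- `P_H V_s(x)|_{K ⊖ H} = 0` -/
  compress_orthogonal : ∀ (s : M) (x : X.fiber s), ∀ k ∈ (LinearMap.range J.toLinearMap)ᗮ,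
    rangeProj J (V.T s x k) = 0
  /-- `K` is the closed span of the `V_s(x) h` -/
  minimal : (Submodule.span ℂ {k : K | ∃ s x h, V.T s x (J h) = k}).topologicalClosure = ⊤

end Representation

end PreProductSystem

/-!
The dilation is an inductive limit. Since `(σ, T)` is fully coisometric, the adjoints
`W_t = T̃_t* : H → X(t) ⊗_σ H` are isometries, and they intertwine the actions of `A`, so that
`1 ⊗ W_t` is an isometry `X(s) ⊗_σ H → X(s) ⊗ X(t) ⊗_σ H = X(s + t) ⊗_σ H` (`incl`). Because
`T̃_{s+t} = T̃_s (1 ⊗ T̃_t)`, these isometries form a directed system over `S` with its divisibility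
order, which under the hypothesis on `S` is the pointwise order. Let `K` be its Hilbert space limit.

The creation operators `y ⊗ h ↦ xy ⊗ h` (`creation`) commute with the isometries `1 ⊗ W_t` and
pass to operators `V_s(x)` on `K` (`exists_limit_creation`). They satisfy
`V_s(x)* V_s(y) = ρ(⟨x, y⟩)` with `ρ(a) = V_0(a)`, because they do so on each `X(t) ⊗_σ H`. The space
`H`, embedded in each `X(s) ⊗_σ H` by `W_s`, sits in `K` in one way only, and `P_H` restricts to
`T̃_s` on `X(s) ⊗_σ H`. Hence `P_H V_s(x) = T_s(x) P_H`, which contains all the dilation properties,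
and `V_s(x) h = x ⊗ h`, which is minimality. Finally, `V` is fully coisometric because every element
of the limit comes from some `X(s + t) ⊗_σ H`, where the vectors `xy ⊗ h` are total
(`HasDenseProducts`). In the `W*` case this last fact uses that the vector functionals of `σ` are
normal, and `ρ` is normal because the positive forms `a ↦ ⟪k, ρ(a) k⟫` are normal for the total set
of vectors `k = V_s(x) h` (`isNormalRep_of_dense`).
-/

/-! ### Maps out of `E ⊗_σ H` -/

namespace CStarCorr

variable {A : Type u} [CStarAlgebra A] [PartialOrder A] [StarOrderedRing A]
  (E : CStarCorr.{u, v} A)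

/-- The left action of `a` on the algebraic tensor product. -/
noncomputable def preLeft (H : Type w) [AddCommGroup H] [Module ℂ H] (a : A) :
    E ⊗[ℂ] H →ₗ[ℂ] E ⊗[ℂ] H :=
  TensorProduct.map
    { toFun := fun y : E => a • y
      map_add' := smul_add a
      map_smul' := fun c y => by
        -- Scalars act through `A`, as `c • z = (c • 1) • z`.
        have h1 : ∀ z : E, (c • (1 : A)) • z = c • z := fun z => by
          rw [E.smul_left_smul, one_smul]
        simp only [RingHom.id_apply]
        rw [← h1, ← h1, smul_smul, smul_smul, mul_smul_one, smul_one_mul] }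
    LinearMap.id

lemma preLeft_tmul {H : Type w} [AddCommGroup H] [Module ℂ H] (a : A) (y : E) (h : H) :
    E.preLeft H a (y ⊗ₜ h) = (a • y) ⊗ₜ h := rfl

variable {H : Type w} [NormedAddCommGroup H] [InnerProductSpace ℂ H] [CompleteSpace H]
  (σ : A →⋆ₙₐ[ℂ] (H →L[ℂ] H))

/-- The canonical map from the algebraic tensor product into its Hausdorff completion. -/
noncomputable def toInterior : E ⊗[ℂ] H →ₗ[ℂ] E.InteriorTensor σ :=
  let ι : E.PreTensor σ →ₗ[ℂ] E.InteriorTensor σ :=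
    (UniformSpace.Completion.toComplL (𝕜 := ℂ) (E := E.PreTensor σ)).toLinearMap
  ι

lemma toInterior_tmul (x : E) (h : H) : E.toInterior σ (x ⊗ₜ h) = E.tmul σ x h := rfl

lemma denseRange_toInterior : DenseRange (E.toInterior σ) :=
  UniformSpace.Completion.denseRange_coe (α := E.PreTensor σ)

lemma inner_toInterior (a b : E ⊗[ℂ] H) :
    inner ℂ (E.toInterior σ a) (E.toInterior σ b) = E.preInner σ a b :=
  UniformSpace.Completion.inner_coe (𝕜 := ℂ) (E := E.PreTensor σ) a b

lemma norm_sq_toInterior (a : E ⊗[ℂ] H) :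
    ‖E.toInterior σ a‖ ^ 2 = (E.preInner σ a a).re := by
  rw [← inner_toInterior, ← inner_self_eq_norm_sq (𝕜 := ℂ)]
  rfl

lemma tmul_add_left (x y : E) (h : H) : E.tmul σ (x + y) h = E.tmul σ x h + E.tmul σ y h := by
  simp only [← toInterior_tmul, TensorProduct.add_tmul, map_add]

lemma tmul_sub_left (x y : E) (h : H) : E.tmul σ (x - y) h = E.tmul σ x h - E.tmul σ y h := by
  simp only [← toInterior_tmul, TensorProduct.sub_tmul, map_sub]

lemma tmul_smul_left (c : ℂ) (x : E) (h : H) : E.tmul σ (c • x) h = c • E.tmul σ x h := by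
  rw [← toInterior_tmul, ← TensorProduct.smul_tmul', map_smul, toInterior_tmul]

lemma norm_sq_tmul (x : E) (h : H) :
    ‖E.tmul σ x h‖ ^ 2 = ‖inner ℂ h (σ (E.ip x x) h)‖ := by
  rw [← inner_tmul_tmul, inner_self_eq_norm_sq_to_K]
  simp

lemma norm_ip_self (x : E) : ‖E.ip x x‖ = ‖x‖ ^ 2 := by
  rw [E.norm_eq, Real.sq_sqrt (norm_nonneg _)]

lemma norm_tmul_le (x : E) (h : H) : ‖E.tmul σ x h‖ ≤ ‖x‖ * ‖h‖ := by
  refine le_of_sq_le_sq ?_ (by positivity)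
  rw [norm_sq_tmul, mul_pow, ← norm_ip_self]
  calc ‖inner ℂ h (σ (E.ip x x) h)‖ ≤ ‖h‖ * (‖σ (E.ip x x)‖ * ‖h‖) :=
        (norm_inner_le_norm _ _).trans (by gcongr; exact ContinuousLinearMap.le_opNorm _ _)
    _ ≤ ‖h‖ * (‖E.ip x x‖ * ‖h‖) := by
        gcongr
        exact NonUnitalStarAlgHom.norm_apply_le σ _
    _ = _ := by ring

lemma span_tmul_dense :
    (Submodule.span ℂ {z | ∃ x h, E.tmul σ x h = z}).topologicalClosure = ⊤ := by
  rw [← Submodule.dense_iff_topologicalClosure_eq_top]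
  refine (E.denseRange_toInterior σ).mono ?_
  rintro _ ⟨a, rfl⟩
  induction a using TensorProduct.induction_on with
  | zero => simp
  | add a b ha hb => rw [map_add]; exact Submodule.add_mem _ ha hb
  | tmul x h => exact Submodule.subset_span ⟨x, h, rfl⟩

variable {E σ} in
lemma interior_ext {G : Type*} [AddCommGroup G] [Module ℂ G] [TopologicalSpace G] [T2Space G]
    {f g : E.InteriorTensor σ →L[ℂ] G} (h : ∀ x k, f (E.tmul σ x k) = g (E.tmul σ x k)) :
    f = g := by
  refine ContinuousLinearMap.ext_on
    (Submodule.dense_iff_topologicalClosure_eq_top.mpr (E.span_tmul_dense σ)) ?_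
  rintro _ ⟨x, k, rfl⟩
  exact h x k

/-- A bilinear map that respects the semi-inner product of `E ⊗ H` induces an isometry of
`E ⊗_σ H`. -/
lemma exists_interior_isometry {G : Type*} [NormedAddCommGroup G] [InnerProductSpace ℂ G]
    [CompleteSpace G] (φ : E →ₗ[ℂ] H →ₗ[ℂ] G)
    (hφ : ∀ x y h g, inner ℂ (φ x h) (φ y g) = inner ℂ h (σ (E.ip x y) g)) :
    ∃ Φ : E.InteriorTensor σ →ₗᵢ[ℂ] G, ∀ x h, Φ (E.tmul σ x h) = φ x h := by
  have hin : ∀ a b, inner ℂ (TensorProduct.lift φ a) (TensorProduct.lift φ b) =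
      E.preInner σ a b := by
    intro a b
    induction a using TensorProduct.induction_on with
    | zero => simp
    | add a₁ a₂ h₁ h₂ => rw [map_add, inner_add_left, h₁, h₂, map_add, LinearMap.add_apply]
    | tmul x h =>
      induction b using TensorProduct.induction_on with
      | zero => simp
      | add b₁ b₂ h₁ h₂ => rw [map_add, inner_add_right, h₁, h₂, map_add]
      | tmul y g => rw [TensorProduct.lift.tmul, TensorProduct.lift.tmul, hφ, preInner_tmul]
  have hn : ∀ a, ‖TensorProduct.lift φ a‖ = ‖E.toInterior σ a‖ := by
    intro a
    refine (sq_eq_sq₀ (norm_nonneg _) (norm_nonneg _)).mp ?_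
    rw [norm_sq_toInterior, ← hin, ← inner_self_eq_norm_sq (𝕜 := ℂ)]
    rfl
  have heq : ∀ a, (TensorProduct.lift φ).extendOfNorm (E.toInterior σ) (E.toInterior σ a) =
      TensorProduct.lift φ a :=
    LinearMap.extendOfNorm_eq (E.denseRange_toInterior σ) ⟨1, fun a => by rw [hn, one_mul]⟩
  refine ⟨⟨((TensorProduct.lift φ).extendOfNorm (E.toInterior σ)).toLinearMap, fun z => ?_⟩,
    fun x h => ?_⟩
  · refine (E.denseRange_toInterior σ).induction ?_ (isClosed_eq ?_ continuous_norm) z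
    · rintro _ ⟨a, rfl⟩
      exact (congrArg norm (heq a)).trans (hn a)
    · exact ((TensorProduct.lift φ).extendOfNorm (E.toInterior σ)).continuous.norm
  · exact (heq (x ⊗ₜ h)).trans (TensorProduct.lift.tmul x h)

/-- An `A`-valued form `⟨y, b y'⟩` with `b ≥ 0` is dominated by `‖b‖` times the inner product, also
after tensoring with `H`. -/
lemma preInner_preLeft_le {b : A} (hb : 0 ≤ b) (ζ : E ⊗[ℂ] H) :
    (E.preInner σ ζ (E.preLeft H b ζ)).re ≤ ‖b‖ * (E.preInner σ ζ ζ).re := by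
  have hadj : ∀ (a : A) (ζ ζ' : E ⊗[ℂ] H),
      E.preInner σ (E.preLeft H a ζ) ζ' = E.preInner σ ζ (E.preLeft H (star a) ζ') := by
    intro a ζ ζ'
    induction ζ using TensorProduct.induction_on with
    | zero => simp
    | add a₁ a₂ h₁ h₂ => simp only [map_add, LinearMap.add_apply, h₁, h₂]
    | tmul x h =>
      induction ζ' using TensorProduct.induction_on with
      | zero => simp
      | add b₁ b₂ h₁ h₂ => simp only [map_add, h₁, h₂]
      | tmul y g =>
        rw [preLeft_tmul, preLeft_tmul, preInner_tmul, preInner_tmul, E.ip_left_smul]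
  have hmul : ∀ (a c : A) (ζ : E ⊗[ℂ] H),
      E.preLeft H (a * c) ζ = E.preLeft H a (E.preLeft H c ζ) := by
    intro a c ζ
    induction ζ using TensorProduct.induction_on with
    | zero => simp
    | add a₁ a₂ h₁ h₂ => simp only [map_add, h₁, h₂]
    | tmul x h => simp only [preLeft_tmul, mul_smul]
  have hsub : ∀ ζ : E ⊗[ℂ] H,
      E.preLeft H (algebraMap ℂ A ‖b‖ - b) ζ = (‖b‖ : ℂ) • ζ - E.preLeft H b ζ := by
    intro ζ
    induction ζ using TensorProduct.induction_on with
    | zero => simp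
    | add a₁ a₂ h₁ h₂ => rw [map_add, h₁, h₂, map_add, smul_add]; abel
    | tmul x h =>
      rw [preLeft_tmul, preLeft_tmul, sub_smul, Algebra.algebraMap_eq_smul_one, E.smul_left_smul,
        one_smul, TensorProduct.sub_tmul, TensorProduct.smul_tmul']
  have hle : b ≤ algebraMap ℂ A ‖b‖ := by
    have := IsSelfAdjoint.le_algebraMap_norm_self (IsSelfAdjoint.of_nonneg hb)
    rwa [IsScalarTower.algebraMap_apply ℝ ℂ A] at this
  obtain ⟨c, hc⟩ := CStarAlgebra.nonneg_iff_eq_star_mul_self.mp (sub_nonneg.mpr hle)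
  have h0 := E.preInner_self_nonneg σ (E.preLeft H c ζ)
  rw [hadj, ← hmul, ← hc, hsub, map_sub, map_smul, Complex.sub_re, smul_eq_mul,
    Complex.re_ofReal_mul] at h0
  linarith

variable {E} in
/-- A linear map `φ` of correspondences with `⟨φ y, φ y'⟩ = ⟨y, b y'⟩` tensors with the identity of
`H` to a bounded operator, of norm at most `‖b‖^{1/2}`. -/
lemma exists_interior_map {F : CStarCorr.{u, v} A} (φ : E →ₗ[ℂ] F) {b : A} (hb : 0 ≤ b)
    (hφ : ∀ y y', F.ip (φ y) (φ y') = E.ip y (b • y')) :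
    ∃ Φ : E.InteriorTensor σ →L[ℂ] F.InteriorTensor σ,
      (∀ y h, Φ (E.tmul σ y h) = F.tmul σ (φ y) h) ∧ ∀ ζ, ‖Φ ζ‖ ≤ √‖b‖ * ‖ζ‖ := by
  set ℓ : E ⊗[ℂ] H →ₗ[ℂ] F ⊗[ℂ] H := TensorProduct.map φ LinearMap.id
  have hin : ∀ a c, F.preInner σ (ℓ a) (ℓ c) = E.preInner σ a (E.preLeft H b c) := by
    intro a c
    induction a using TensorProduct.induction_on with
    | zero => simp
    | add a₁ a₂ h₁ h₂ => simp only [map_add, LinearMap.add_apply, h₁, h₂]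
    | tmul x h =>
      induction c using TensorProduct.induction_on with
      | zero => simp
      | add b₁ b₂ h₁ h₂ => simp only [map_add, h₁, h₂]
      | tmul y g =>
        rw [preLeft_tmul, preInner_tmul, ← hφ]
        rfl
  have hn : ∀ a, ‖(F.toInterior σ ∘ₗ ℓ) a‖ ≤ √‖b‖ * ‖E.toInterior σ a‖ := by
    intro a
    refine le_of_sq_le_sq ?_ (by positivity)
    rw [LinearMap.comp_apply, norm_sq_toInterior, mul_pow, Real.sq_sqrt (norm_nonneg _),
      norm_sq_toInterior, hin]
    exact E.preInner_preLeft_le σ hb a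
  refine ⟨(F.toInterior σ ∘ₗ ℓ).extendOfNorm (E.toInterior σ), fun y h => ?_,
    LinearMap.norm_extendOfNorm_apply_le (E.denseRange_toInterior σ) _ hn⟩
  exact LinearMap.extendOfNorm_eq (E.denseRange_toInterior σ) ⟨_, hn⟩ (y ⊗ₜ h)

/-- An isometric map of a correspondence is completely contractive: amplification to matrices carries
`T(x)* T(y) = σ(⟨x, y⟩)` to the matrix algebras, where `*`-homomorphisms are contractive. -/
lemma IsIsometricRep.isCompletelyBounded {E : CStarCorr.{u, v} A}
    {σ : A →⋆ₙₐ[ℂ] (H →L[ℂ] H)} {T : E →ₗ[ℂ] (H →L[ℂ] H)} (hT : IsIsometricRep σ T) :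
    IsCompletelyBounded T := by
  refine ⟨1, fun n x => ?_⟩
  rw [one_mul]
  refine Real.le_sqrt_of_sq_le ?_
  set B : CStarMatrix (Fin n) (Fin n) (H →L[ℂ] H) := CStarMatrix.ofMatrix fun i j => T (x i j)
  set Q : CStarMatrix (Fin n) (Fin n) A :=
    CStarMatrix.ofMatrix fun i j => ∑ k, E.ip (x k i) (x k j)
  have hBQ : star B * B = CStarMatrix.mapₙₐ σ Q := by
    ext1 i j
    rw [CStarMatrix.mul_apply]
    simp only [CStarMatrix.star_apply]
    change ∑ k, star (T (x k i)) * T (x k j) = σ (∑ k, E.ip (x k i) (x k j))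
    rw [map_sum]
    exact Finset.sum_congr rfl fun k _ => hT _ _
  rw [pow_two, ← CStarRing.norm_star_mul_self, hBQ]
  exact NonUnitalStarAlgHom.norm_apply_le (CStarMatrix.mapₙₐ σ) Q

/-- An isometric representation whose vectors `T(x) h` span a dense subspace is fully
coisometric. -/
lemma IsIsometricRep.isFullyCoisometricRep {E : CStarCorr.{u, v} A}
    {σ : A →⋆ₙₐ[ℂ] (H →L[ℂ] H)} {T : E →ₗ[ℂ] (H →L[ℂ] H)} (hT : IsIsometricRep σ T)
    (hd : (Submodule.span ℂ {k : H | ∃ x h, T x h = k}).topologicalClosure = ⊤) :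
    IsFullyCoisometricRep σ T := by
  obtain ⟨Φ, hΦ⟩ := E.exists_interior_isometry σ (G := H)
    (LinearMap.mk₂ ℂ (fun x h => T x h) (by intros; simp) (by intros; simp) (by intros; simp)
      (by intros; simp))
    (fun x y h g => by
      simp only [LinearMap.mk₂_apply]
      rw [← hT x y, ContinuousLinearMap.star_eq_adjoint, mul_apply_eq_comp,
        ContinuousLinearMap.adjoint_inner_right])
  refine ⟨Φ.toContinuousLinearMap, hΦ, ?_⟩
  have hli : ContinuousLinearMap.adjoint Φ.toContinuousLinearMap ∘L Φ.toContinuousLinearMap =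
      ContinuousLinearMap.id ℂ _ := by
    ext1 z
    refine ext_inner_left ℂ fun y => ?_
    simp
  refine ContinuousLinearMap.ext_on (Submodule.dense_iff_topologicalClosure_eq_top.mpr hd) ?_
  rintro _ ⟨x, h, rfl⟩
  have h1 : T x h = Φ.toContinuousLinearMap (E.tmul σ x h) := (hΦ x h).symm
  rw [h1]
  exact congrArg Φ (DFunLike.congr_fun hli (E.tmul σ x h))

end CStarCorr

/-! ### Creation operators -/

namespace PreProductSystem

variable {M : Type*} [AddCommMonoid M] {A : Type u} [CStarAlgebra A] [PartialOrder A]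
  [StarOrderedRing A] (X : PreProductSystem.{u, v} M A)
  {H : Type w} [NormedAddCommGroup H] [InnerProductSpace ℂ H] [CompleteSpace H]
  (σ : A →⋆ₙₐ[ℂ] (H →L[ℂ] H)) {s t r : M}

lemma exists_creation (e : s + t = r) (x : X.fiber s) :
    ∃ Φ : (X.fiber t).InteriorTensor σ →L[ℂ] (X.fiber r).InteriorTensor σ,
      (∀ y h, Φ ((X.fiber t).tmul σ y h) = (X.fiber r).tmul σ (X.mul e x y) h) ∧
        ∀ ζ, ‖Φ ζ‖ ≤ √‖(X.fiber s).ip x x‖ * ‖ζ‖ :=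
  CStarCorr.exists_interior_map σ (X.mul e x) ((X.fiber s).ip_self_nonneg x) fun y y' =>
    X.ip_mul e x x y y'

/-- The creation operator `X(t) ⊗_σ H → X(s + t) ⊗_σ H`, `y ⊗ h ↦ xy ⊗ h`, of `x ∈ X(s)`. -/
noncomputable def creation (e : s + t = r) (x : X.fiber s) :
    (X.fiber t).InteriorTensor σ →L[ℂ] (X.fiber r).InteriorTensor σ :=
  (X.exists_creation σ e x).choose

@[simp]
lemma creation_tmul (e : s + t = r) (x : X.fiber s) (y : X.fiber t) (h : H) :
    X.creation σ e x ((X.fiber t).tmul σ y h) = (X.fiber r).tmul σ (X.mul e x y) h :=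
  (X.exists_creation σ e x).choose_spec.1 y h

lemma norm_creation_le (e : s + t = r) (x : X.fiber s) (ζ : (X.fiber t).InteriorTensor σ) :
    ‖X.creation σ e x ζ‖ ≤ ‖x‖ * ‖ζ‖ := by
  rw [(X.fiber s).norm_eq x]
  exact (X.exists_creation σ e x).choose_spec.2 ζ

lemma creation_add (e : s + t = r) (x y : X.fiber s) :
    X.creation σ e (x + y) = X.creation σ e x + X.creation σ e y :=
  CStarCorr.interior_ext fun z h => by simp [CStarCorr.tmul_add_left]

lemma creation_smul (e : s + t = r) (c : ℂ) (x : X.fiber s) :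
    X.creation σ e (c • x) = c • X.creation σ e x :=
  CStarCorr.interior_ext fun z h => by simp [CStarCorr.tmul_smul_left]

lemma creation_mul {st tr str : M} (e₁ : s + t = st) (e₂ : st + r = str) (e₃ : t + r = tr)
    (e₄ : s + tr = str) (x : X.fiber s) (y : X.fiber t) :
    X.creation σ e₂ (X.mul e₁ x y) = X.creation σ e₄ x ∘L X.creation σ e₃ y :=
  CStarCorr.interior_ext fun z h => by simp [X.mul_assoc e₁ e₂ e₃ e₄]

/-- The creation operators of `X(s)` form an isometric representation of the correspondence, where
`A = X(0)` acts by its own creation operators. -/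
lemma inner_creation_creation (e : s + t = r) (x x' : X.fiber s)
    (ζ ζ' : (X.fiber t).InteriorTensor σ) :
    inner ℂ (X.creation σ e x ζ) (X.creation σ e x' ζ') =
      inner ℂ ζ (X.creation σ (zero_add t) (X.unit ((X.fiber s).ip x x')) ζ') := by
  have : ContinuousLinearMap.adjoint (X.creation σ e x) ∘L X.creation σ e x' =
      X.creation σ (zero_add t) (X.unit ((X.fiber s).ip x x')) := by
    refine CStarCorr.interior_ext fun y' g => ?_
    refine ext_inner_left ℂ fun ζ => ?_
    rw [ContinuousLinearMap.comp_apply, ContinuousLinearMap.adjoint_inner_right]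
    have hz : innerSL ℂ (X.creation σ e x' ((X.fiber t).tmul σ y' g)) ∘L X.creation σ e x =
        innerSL ℂ (X.creation σ (zero_add t) (X.unit ((X.fiber s).ip x x'))
          ((X.fiber t).tmul σ y' g)) := by
      refine CStarCorr.interior_ext fun y h => ?_
      simp only [ContinuousLinearMap.comp_apply, innerSL_apply_apply, creation_tmul, X.unit_mul,
        CStarCorr.inner_tmul_tmul, X.ip_mul, CStarCorr.ip_left_smul, CStarCorr.star_ip]
    have := DFunLike.congr_fun hz ζ
    simp only [ContinuousLinearMap.comp_apply, innerSL_apply_apply] at this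
    rw [← inner_conj_symm, this, inner_conj_symm]
  rw [← this, ContinuousLinearMap.comp_apply, ContinuousLinearMap.adjoint_inner_right]

lemma creation_unit_one :
    X.creation σ (zero_add t) (X.unit 1) = ContinuousLinearMap.id ℂ _ :=
  CStarCorr.interior_ext fun z h => by simp [X.unit_mul]

lemma inner_creation_unit_left (a : A) (ζ ζ' : (X.fiber t).InteriorTensor σ) :
    inner ℂ (X.creation σ (zero_add t) (X.unit a) ζ) ζ' =
      inner ℂ ζ (X.creation σ (zero_add t) (X.unit (star a)) ζ') := by
  have h := X.inner_creation_creation σ (zero_add t) (X.unit a) (X.unit 1) ζ ζ'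
  rwa [X.creation_unit_one, X.ip_unit, mul_one] at h

/-- The multiplication of `X` has dense range after tensoring with `H`: this is the form in which the
surjectivity of the maps `X(s) ⊗_A X(t) → X(s + t)` enters. -/
def HasDenseProducts : Prop :=
  ∀ ⦃s t r : M⦄ (e : s + t = r),
    (Submodule.span ℂ {z : (X.fiber r).InteriorTensor σ |
      ∃ x ζ, X.creation σ e x ζ = z}).topologicalClosure = ⊤

variable {X} in
lemma hasDenseProducts_of_approx
    (h : ∀ (s t : M) (z : X.fiber (s + t)) (h : H) (ε : ℝ), 0 < ε →
      ∃ y ∈ X.products s t, ‖(X.fiber (s + t)).tmul σ (z - y) h‖ < ε) :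
    X.HasDenseProducts σ := by
  rintro s t _ rfl
  rw [eq_top_iff, ← (X.fiber (s + t)).span_tmul_dense σ]
  refine Submodule.topologicalClosure_minimal _ (Submodule.span_le.mpr ?_)
    (Submodule.isClosed_topologicalClosure _)
  rintro _ ⟨z, k, rfl⟩
  refine Metric.mem_closure_iff.mpr fun ε hε => ?_
  obtain ⟨y, hy, hlt⟩ := h s t z k ε hε
  refine ⟨(X.fiber (s + t)).tmul σ y k, ?_, by rwa [dist_eq_norm, ← CStarCorr.tmul_sub_left]⟩
  clear hlt
  induction hy using Submodule.span_induction with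
  | mem w hw =>
    obtain ⟨a, b, rfl⟩ := hw
    exact Submodule.subset_span ⟨a, (X.fiber t).tmul σ b k, X.creation_tmul σ rfl a b k⟩
  | zero =>
    have : (X.fiber (s + t)).tmul σ 0 k = 0 := by
      simpa using (X.fiber (s + t)).tmul_smul_left σ 0 0 k
    rw [this]
    exact Submodule.zero_mem _
  | add a b _ _ ha hb =>
    rw [CStarCorr.tmul_add_left]
    exact Submodule.add_mem _ ha hb
  | smul c a _ ha =>
    rw [CStarCorr.tmul_smul_left]
    exact Submodule.smul_mem _ c ha

variable {X} in
lemma IsProductSystem.hasDenseProducts (hX : X.IsProductSystem) : X.HasDenseProducts σ := by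
  refine hasDenseProducts_of_approx σ fun s t z h ε hε => ?_
  have hz : z ∈ closure (X.products s t : Set (X.fiber (s + t))) := by
    rw [← Submodule.topologicalClosure_coe, hX s t]
    trivial
  obtain ⟨y, hy, hlt⟩ := Metric.mem_closure_iff.mp hz (ε / (‖h‖ + 1)) (by positivity)
  refine ⟨y, hy, ((X.fiber (s + t)).norm_tmul_le σ _ h).trans_lt ?_⟩
  rw [dist_eq_norm, lt_div_iff₀ (by positivity)] at hlt
  nlinarith [norm_nonneg (z - y)]

/-- The vector functionals of a normal representation are normal. -/
lemma isNormalPositiveFunctional_vector {σ : A →⋆ₙₐ[ℂ] (H →L[ℂ] H)} (hσ : IsNormalRep σ)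
    (h : H) :
    IsNormalPositiveFunctional
      ((innerSL ℂ h).toLinearMap ∘ₗ (ContinuousLinearMap.apply ℂ H h).toLinearMap ∘ₗ
        (σ : A →ₗ[ℂ] (H →L[ℂ] H))) := by
  refine ⟨fun a ha => ?_, hσ h⟩
  obtain ⟨b, rfl⟩ := CStarAlgebra.nonneg_iff_eq_star_mul_self.mp ha
  change 0 ≤ inner ℂ h (σ (star b * b) h)
  rw [map_mul, map_star, ContinuousLinearMap.star_eq_adjoint, mul_apply_eq_comp,
    ContinuousLinearMap.adjoint_inner_right, inner_self_eq_norm_sq_to_K]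
  have h0 : (0 : ℂ) ≤ ((‖σ b h‖ ^ 2 : ℝ) : ℂ) := Complex.zero_le_real.mpr (sq_nonneg _)
  rwa [Complex.ofReal_pow] at h0

variable {X} in
lemma IsWStarProductSystem.hasDenseProducts (hX : X.IsWStarProductSystem)
    {σ : A →⋆ₙₐ[ℂ] (H →L[ℂ] H)} (hσ : IsNormalRep σ) : X.HasDenseProducts σ := by
  refine hasDenseProducts_of_approx σ fun s t z h ε hε => ?_
  obtain ⟨y, hy, hlt⟩ := hX.2 s t z _ (isNormalPositiveFunctional_vector hσ h) (ε ^ 2)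
    (by positivity)
  refine ⟨y, hy, lt_of_pow_lt_pow_left₀ 2 hε.le ?_⟩
  rw [CStarCorr.norm_sq_tmul]
  exact hlt

end PreProductSystem

/-! ### The isometries `X(s) ⊗_σ H → X(s + t) ⊗_σ H` -/

namespace PreProductSystem.Representation

variable {M : Type*} [AddCommMonoid M] {A : Type u} [CStarAlgebra A] [PartialOrder A]
  [StarOrderedRing A] {X : PreProductSystem.{u, v} M A}
  {H : Type w} [NormedAddCommGroup H] [InnerProductSpace ℂ H] [CompleteSpace H]
  {R : X.Representation H} (hR : R.IsFullyCoisometric) {s t r : M}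

/-- The coisometry `T̃_s : X(s) ⊗_σ H → H`, `x ⊗ h ↦ T_s(x) h`. -/
noncomputable def coiso (s : M) : (X.fiber s).InteriorTensor R.σ →L[ℂ] H := (hR s).choose

/-- The isometry `W_s = T̃_s* : H → X(s) ⊗_σ H`. -/
noncomputable def coext (s : M) : H →L[ℂ] (X.fiber s).InteriorTensor R.σ :=
  ContinuousLinearMap.adjoint (coiso hR s)

@[simp]
lemma coiso_tmul (x : X.fiber s) (h : H) :
    coiso hR s ((X.fiber s).tmul R.σ x h) = R.T s x h :=
  (hR s).choose_spec.1 x h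

@[simp]
lemma coiso_coext (h : H) : coiso hR s (coext hR s h) = h :=
  DFunLike.congr_fun (hR s).choose_spec.2 h

lemma inner_coext_left (h : H) (ζ : (X.fiber s).InteriorTensor R.σ) :
    inner ℂ (coext hR s h) ζ = inner ℂ h (coiso hR s ζ) :=
  ContinuousLinearMap.adjoint_inner_left _ _ _

lemma inner_coext_right (h : H) (ζ : (X.fiber s).InteriorTensor R.σ) :
    inner ℂ ζ (coext hR s h) = inner ℂ (coiso hR s ζ) h :=
  ContinuousLinearMap.adjoint_inner_right _ _ _

@[simp]
lemma norm_coext (h : H) : ‖coext hR s h‖ = ‖h‖ := by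
  rw [← sq_eq_sq₀ (norm_nonneg _) (norm_nonneg _), ← inner_self_eq_norm_sq (𝕜 := ℂ),
    ← inner_self_eq_norm_sq (𝕜 := ℂ), inner_coext_left, coiso_coext]

/-- The initial space of the coisometry `T̃_s` consists of the vectors on which it preserves the
norm. -/
lemma eq_coext_of_norm_le {ζ : (X.fiber s).InteriorTensor R.σ} {h : H}
    (hζ : coiso hR s ζ = h) (hn : ‖ζ‖ ≤ ‖h‖) : ζ = coext hR s h := by
  have h2 : ‖ζ - coext hR s h‖ ^ 2 ≤ 0 := by
    rw [norm_sub_sq (𝕜 := ℂ), inner_coext_right, hζ, inner_self_eq_norm_sq, norm_coext]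
    nlinarith [norm_nonneg ζ]
  have := pow_eq_zero_iff two_ne_zero |>.mp (le_antisymm h2 (sq_nonneg _))
  exact sub_eq_zero.mp (norm_eq_zero.mp this)

/-- `T̃_{s+t} = T̃_s (1 ⊗ T̃_t)`. -/
@[simp]
lemma coiso_creation (e : s + t = r) (x : X.fiber s) (ζ : (X.fiber t).InteriorTensor R.σ) :
    coiso hR r (X.creation R.σ e x ζ) = R.T s x (coiso hR t ζ) := by
  have : coiso hR r ∘L X.creation R.σ e x = R.T s x ∘L coiso hR t :=
    CStarCorr.interior_ext fun y h => by simp [R.map_mul e]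
  exact DFunLike.congr_fun this ζ

/-- `W_t` intertwines the two actions of `A`. -/
lemma creation_unit_coext (a : A) (h : H) :
    X.creation R.σ (zero_add t) (X.unit a) (coext hR t h) = coext hR t (R.σ a h) := by
  refine ext_inner_left ℂ fun ζ => ?_
  rw [← star_star a, ← inner_creation_unit_left, star_star, inner_coext_right, coiso_creation,
    R.T_unit, inner_coext_right, map_star, ContinuousLinearMap.star_eq_adjoint,
    ContinuousLinearMap.adjoint_inner_left]

lemma exists_incl (e : s + t = r) :
    ∃ Φ : (X.fiber s).InteriorTensor R.σ →ₗᵢ[ℂ] (X.fiber r).InteriorTensor R.σ,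
      ∀ x h, Φ ((X.fiber s).tmul R.σ x h) = X.creation R.σ e x (coext hR t h) :=
  (X.fiber s).exists_interior_isometry R.σ
    (LinearMap.mk₂ ℂ (fun x h => X.creation R.σ e x (coext hR t h))
      (by intros; simp [creation_add]) (by intros; simp [creation_smul]) (by intros; simp)
      (by intros; simp))
    (fun x y h g => by
      simp only [LinearMap.mk₂_apply]
      rw [inner_creation_creation, creation_unit_coext, inner_coext_left, coiso_coext])

/-- The isometry `1 ⊗ W_t : X(s) ⊗_σ H → X(s) ⊗ X(t) ⊗_σ H = X(s + t) ⊗_σ H`. -/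
noncomputable def incl (e : s + t = r) :
    (X.fiber s).InteriorTensor R.σ →ₗᵢ[ℂ] (X.fiber r).InteriorTensor R.σ :=
  (exists_incl hR e).choose

lemma incl_tmul (e : s + t = r) (x : X.fiber s) (h : H) :
    incl hR e ((X.fiber s).tmul R.σ x h) = X.creation R.σ e x (coext hR t h) :=
  (exists_incl hR e).choose_spec x h

lemma coiso_incl (e : s + t = r) (ζ : (X.fiber s).InteriorTensor R.σ) :
    coiso hR r (incl hR e ζ) = coiso hR s ζ := by
  have : coiso hR r ∘L (incl hR e).toContinuousLinearMap = coiso hR s :=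
    CStarCorr.interior_ext fun y h => by simp [incl_tmul]
  exact DFunLike.congr_fun this ζ

lemma incl_coext (e : s + t = r) (h : H) : incl hR e (coext hR s h) = coext hR r h :=
  eq_coext_of_norm_le hR (by rw [coiso_incl, coiso_coext]) (by simp)

lemma incl_creation {st tr str : M} (e₁ : s + t = st) (e₂ : st + r = str) (e₃ : t + r = tr)
    (e₄ : s + tr = str) (x : X.fiber s) (ζ : (X.fiber t).InteriorTensor R.σ) :
    incl hR e₂ (X.creation R.σ e₁ x ζ) = X.creation R.σ e₄ x (incl hR e₃ ζ) := by
  have : (incl hR e₂).toContinuousLinearMap ∘L X.creation R.σ e₁ x =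
      X.creation R.σ e₄ x ∘L (incl hR e₃).toContinuousLinearMap :=
    CStarCorr.interior_ext fun y h => by
      simp [incl_tmul, X.creation_mul R.σ e₁ e₂ e₃ e₄]
  exact DFunLike.congr_fun this ζ

lemma incl_incl {st tr str : M} (e₁ : s + t = st) (e₂ : st + r = str) (e₃ : t + r = tr)
    (e₄ : s + tr = str) (ζ : (X.fiber s).InteriorTensor R.σ) :
    incl hR e₂ (incl hR e₁ ζ) = incl hR e₄ ζ := by
  have : (incl hR e₂).toContinuousLinearMap ∘L (incl hR e₁).toContinuousLinearMap =
      (incl hR e₄).toContinuousLinearMap :=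
    CStarCorr.interior_ext fun y h => by
      simp [incl_tmul, incl_creation hR e₁ e₂ e₃ e₄, incl_coext]
  exact DFunLike.congr_fun this ζ

lemma coext_zero (hσ : R.σ 1 = 1) (h : H) :
    coext hR 0 h = (X.fiber 0).tmul R.σ (X.unit 1) h := by
  refine (eq_coext_of_norm_le hR ?_ ?_).symm
  · rw [coiso_tmul, R.T_unit, hσ, one_apply_eq_self]
  · rw [← sq_le_sq₀ (norm_nonneg _) (norm_nonneg _), CStarCorr.norm_sq_tmul, X.ip_unit, star_one,
      mul_one, hσ, one_apply_eq_self, inner_self_eq_norm_sq_to_K]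
    simp

lemma incl_zero (hσ : R.σ 1 = 1) (e : s + 0 = s) (ζ : (X.fiber s).InteriorTensor R.σ) :
    incl hR e ζ = ζ := by
  have : (incl hR e).toContinuousLinearMap = ContinuousLinearMap.id ℂ _ :=
    CStarCorr.interior_ext fun y h => by
      simp [incl_tmul, coext_zero hR hσ, X.mul_unit]
  exact DFunLike.congr_fun this ζ

end PreProductSystem.Representation

/-! ### Inductive limits of Hilbert spaces -/

section HilbertLimit

variable {ι : Type u} [Preorder ι] [IsDirectedOrder ι] {G : ι → Type w}
  [∀ i, NormedAddCommGroup (G i)] [∀ i, InnerProductSpace ℂ (G i)]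
  (f : ∀ i j, i ≤ j → G i →ₗᵢ[ℂ] G j) [DirectedSystem G (f · · ·)]

/-- The inner product on the algebraic direct limit, computed at any common upper index. -/
noncomputable def directLimitInner (a b : DirectLimit G f) : ℂ :=
  DirectLimit.lift₂ f f (fun _ x y => inner ℂ x y)
    (fun i j h x y => ((f i j h).inner_map_map x y).symm) a b

lemma directLimitInner_mk (i : ι) (x y : G i) :
    directLimitInner f (⟦⟨i, x⟩⟧ : DirectLimit G f) (⟦⟨i, y⟩⟧ : DirectLimit G f) = inner ℂ x y :=
  DirectLimit.lift₂_def f f _ _ i x y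

lemma directLimitInner_conj_symm (a b : DirectLimit G f) :
    (starRingEnd ℂ) (directLimitInner f b a) = directLimitInner f a b := by
  obtain ⟨i, x, y, rfl, rfl⟩ := DirectLimit.exists_eq_mk₂ f a b
  rw [directLimitInner_mk, directLimitInner_mk, inner_conj_symm]

lemma directLimitInner_self_nonneg (a : DirectLimit G f) :
    0 ≤ (directLimitInner f a a).re := by
  obtain ⟨i, x, rfl⟩ := DirectLimit.exists_eq_mk f a
  rw [directLimitInner_mk]
  exact inner_self_nonneg (𝕜 := ℂ)

lemma directLimitInner_add_left (a b c : DirectLimit G f) :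
    directLimitInner f (a + b) c = directLimitInner f a c + directLimitInner f b c := by
  obtain ⟨i, x, y, z, rfl, rfl, rfl⟩ := DirectLimit.exists_eq_mk₃ f a b c
  rw [DirectLimit.add_def, directLimitInner_mk, directLimitInner_mk, directLimitInner_mk,
    inner_add_left]

variable [Nonempty ι]

lemma directLimitInner_smul_left (a b : DirectLimit G f) (c : ℂ) :
    directLimitInner f (c • a) b = (starRingEnd ℂ) c * directLimitInner f a b := by
  obtain ⟨i, x, y, rfl, rfl⟩ := DirectLimit.exists_eq_mk₂ f a b
  rw [DirectLimit.smul_def, directLimitInner_mk, directLimitInner_mk, inner_smul_left]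

/-- The algebraic direct limit, to be endowed with its semi-inner product. It is a type synonym
because the quotient `DirectLimit G f` carries the quotient topology as a global instance. -/
def PreHilbertLimit : Type _ := DirectLimit G f

noncomputable instance : AddCommGroup (PreHilbertLimit f) :=
  inferInstanceAs (AddCommGroup (DirectLimit G f))

noncomputable instance : Module ℂ (PreHilbertLimit f) :=
  inferInstanceAs (Module ℂ (DirectLimit G f))

/-- The semi-inner product of the algebraic direct limit. -/
@[reducible]
noncomputable def preHilbertLimitCore : PreInnerProductSpace.Core ℂ (PreHilbertLimit f) where
  inner := directLimitInner f
  conj_inner_symm := directLimitInner_conj_symm f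
  re_inner_nonneg := directLimitInner_self_nonneg f
  add_left := directLimitInner_add_left f
  smul_left := directLimitInner_smul_left f

noncomputable instance : SeminormedAddCommGroup (PreHilbertLimit f) :=
  InnerProductSpace.Core.toSeminormedAddCommGroup (𝕜 := ℂ) (c := preHilbertLimitCore f)

noncomputable instance : InnerProductSpace ℂ (PreHilbertLimit f) :=
  InnerProductSpace.ofCore (preHilbertLimitCore f)

/-- A directed system of inner product spaces and isometries has a limit: a Hilbert space that
contains all of them compatibly, with dense union. -/
lemma exists_hilbert_limit :
    ∃ (K : Type (max u w)) (_ : NormedAddCommGroup K) (_ : InnerProductSpace ℂ K)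
      (_ : CompleteSpace K) (j : ∀ i, G i →ₗᵢ[ℂ] K),
      (∀ i k (h : i ≤ k) x, j k (f i k h x) = j i x) ∧ Dense (⋃ i, Set.range (j i)) := by
  let of : ∀ i, G i →ₗ[ℂ] PreHilbertLimit f := fun i => DirectLimit.Module.of ℂ ι G f i
  let c := UniformSpace.Completion.toComplL (𝕜 := ℂ) (E := PreHilbertLimit f)
  have hj : ∀ i (x : G i), ‖c (of i x)‖ = ‖x‖ := by
    intro i x
    have h1 : inner ℂ (c (of i x)) (c (of i x)) = inner ℂ x x :=
      (UniformSpace.Completion.inner_coe (𝕜 := ℂ) (of i x) (of i x)).trans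
        (directLimitInner_mk f i x x)
    rw [← sq_eq_sq₀ (norm_nonneg _) (norm_nonneg _), ← inner_self_eq_norm_sq (𝕜 := ℂ), h1,
      inner_self_eq_norm_sq]
  refine ⟨UniformSpace.Completion (PreHilbertLimit f), inferInstance, inferInstance,
    inferInstance, fun i => ⟨c.toLinearMap ∘ₗ of i, hj i⟩, fun i k h x => ?_, ?_⟩
  · exact congrArg c (DirectLimit.Module.of_f (R := ℂ) (hij := h) (x := x))
  · refine (UniformSpace.Completion.denseRange_coe (α := PreHilbertLimit f)).mono ?_
    rintro _ ⟨a, rfl⟩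
    obtain ⟨i, x, rfl⟩ := DirectLimit.exists_eq_mk f a
    exact Set.mem_iUnion.mpr ⟨i, x, rfl⟩

variable {f} in
/-- The universal property of the limit for uniformly bounded families of operators. -/
lemma exists_hilbert_limit_lift {K : Type*} [NormedAddCommGroup K] [InnerProductSpace ℂ K]
    {j : ∀ i, G i →ₗᵢ[ℂ] K} (hj : ∀ i k (h : i ≤ k) x, j k (f i k h x) = j i x)
    (hd : Dense (⋃ i, Set.range (j i)))
    {L : Type*} [NormedAddCommGroup L] [InnerProductSpace ℂ L] [CompleteSpace L]
    (g : ∀ i, G i →ₗ[ℂ] L) (hg : ∀ i k (h : i ≤ k) x, g k (f i k h x) = g i x)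
    {C : ℝ} (hC : ∀ i x, ‖g i x‖ ≤ C * ‖x‖) :
    ∃ Φ : K →L[ℂ] L, ∀ i x, Φ (j i x) = g i x := by
  let e : DirectLimit G f →ₗ[ℂ] K := DirectLimit.Module.lift ℂ ι G f (fun i => (j i).toLinearMap) hj
  let φ : DirectLimit G f →ₗ[ℂ] L := DirectLimit.Module.lift ℂ ι G f g hg
  have he : DenseRange e := by
    refine hd.mono (Set.iUnion_subset fun i => ?_)
    rintro _ ⟨x, rfl⟩
    exact ⟨DirectLimit.Module.of ℂ ι G f i x, rfl⟩
  have hb : ∀ a, ‖φ a‖ ≤ C * ‖e a‖ := by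
    intro a
    obtain ⟨i, x, rfl⟩ := DirectLimit.exists_eq_mk f a
    exact (hC i x).trans_eq (congrArg (C * ·) ((j i).norm_map x).symm)
  exact ⟨φ.extendOfNorm e, fun i x =>
    LinearMap.extendOfNorm_eq he ⟨C, hb⟩ (DirectLimit.Module.of ℂ ι G f i x)⟩

end HilbertLimit

/-! ### Normality on a dense set of vectors -/

section Normality

/-- For an increasing function into `ℂ`, preservation of a directed supremum is approximation of the
value at the supremum. -/
lemma isLUB_image_iff_approx {P : Type*} [Preorder P] {f : P → ℂ} (hf : Monotone f)
    {D : Set P} (hD : D.Nonempty) {a : P} (ha : IsLUB D a) :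
    IsLUB (f '' D) (f a) ↔ ∀ ε : ℝ, 0 < ε → ∃ d ∈ D, ‖f a - f d‖ < ε := by
  have him : ∀ d ∈ D, (f d).im = (f a).im ∧ (f d).re ≤ (f a).re := fun d hd =>
    ⟨(Complex.le_def.mp (hf (ha.1 hd))).2, (Complex.le_def.mp (hf (ha.1 hd))).1⟩
  have hnorm : ∀ d ∈ D, ‖f a - f d‖ = (f a).re - (f d).re := by
    intro d hd
    have : f a - f d = (((f a).re - (f d).re : ℝ) : ℂ) := by
      apply Complex.ext <;> simp [(him d hd).1]
    rw [this, Complex.norm_real, Real.norm_of_nonneg (sub_nonneg.mpr (him d hd).2)]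
  constructor
  · intro h ε hε
    by_contra! hcon
    have hub : f a - (ε : ℂ) ∈ upperBounds (f '' D) := by
      rintro _ ⟨d, hd, rfl⟩
      have := hcon d hd
      rw [hnorm d hd] at this
      refine Complex.le_def.mpr ⟨?_, ?_⟩
      · rw [Complex.sub_re, Complex.ofReal_re]; linarith
      · rw [Complex.sub_im, Complex.ofReal_im, sub_zero, (him d hd).1]
    have := (Complex.le_def.mp (h.2 hub)).1
    rw [Complex.sub_re, Complex.ofReal_re] at this
    linarith
  · intro h
    refine ⟨?_, fun c hc => ?_⟩
    · rintro _ ⟨d, hd, rfl⟩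
      exact hf (ha.1 hd)
    · obtain ⟨d₀, hd₀⟩ := hD
      refine Complex.le_def.mpr ⟨le_of_forall_pos_lt_add fun ε hε => ?_, ?_⟩
      · obtain ⟨d, hd, hlt⟩ := h ε hε
        rw [hnorm d hd] at hlt
        have := (Complex.le_def.mp (hc ⟨d, hd, rfl⟩)).1
        linarith
      · rw [← (him d₀ hd₀).1]
        exact (Complex.le_def.mp (hc ⟨d₀, hd₀, rfl⟩)).2

variable {A : Type u} [CStarAlgebra A] [PartialOrder A] [StarOrderedRing A]
  {H : Type w} [NormedAddCommGroup H] [InnerProductSpace ℂ H] [CompleteSpace H]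

lemma inner_map_mono (σ : A →⋆ₙₐ[ℂ] (H →L[ℂ] H)) {a b : A} (hab : a ≤ b) (h : H) :
    inner ℂ h (σ a h) ≤ inner ℂ h (σ b h) := by
  obtain ⟨c, hc⟩ := CStarAlgebra.nonneg_iff_eq_star_mul_self.mp (sub_nonneg.mpr hab)
  rw [← sub_nonneg, ← inner_sub_right, ← sub_apply, ← map_sub, hc, map_mul,
    map_star, ContinuousLinearMap.star_eq_adjoint, mul_apply_eq_comp,
    ContinuousLinearMap.adjoint_inner_right, inner_self_eq_norm_sq_to_K]
  have h0 : (0 : ℂ) ≤ ((‖σ c h‖ ^ 2 : ℝ) : ℂ) := Complex.zero_le_real.mpr (sq_nonneg _)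
  rwa [Complex.ofReal_pow] at h0

/-- Normality need only be tested on vectors with dense linear span. For `d` in a directed set with
supremum `a`, the positive form `⟪h, σ(a - d) h⟫` is the square of a seminorm which is uniformly
bounded along a tail, so the vectors along which it tends to `0` form a closed subspace. -/
lemma isNormalRep_of_dense {σ : A →⋆ₙₐ[ℂ] (H →L[ℂ] H)} {s : Set H}
    (hs : (Submodule.span ℂ s).topologicalClosure = ⊤)
    (hn : ∀ h ∈ s, PreservesDirectedSups fun a : A => inner ℂ h (σ a h)) : IsNormalRep σ := by
  intro h D hDsa hDne hDdir a ha
  have hmono : ∀ h : H, Monotone fun a : A => inner ℂ h (σ a h) :=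
    fun h _ _ hab => inner_map_mono σ hab h
  rw [isLUB_image_iff_approx (hmono h) hDne ha]
  -- A square root of `a - d` turns the form into a norm.
  have hroot : ∀ d ∈ D, ∃ c : A, ∀ k : H,
      inner ℂ k (σ a k) - inner ℂ k (σ d k) = ((‖σ c k‖ ^ 2 : ℝ) : ℂ) := by
    intro d hd
    obtain ⟨c, hc⟩ := CStarAlgebra.nonneg_iff_eq_star_mul_self.mp (sub_nonneg.mpr (ha.1 hd))
    refine ⟨c, fun k => ?_⟩
    rw [← inner_sub_right, ← sub_apply, ← map_sub, hc, map_mul,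
      map_star, ContinuousLinearMap.star_eq_adjoint, mul_apply_eq_comp,
      ContinuousLinearMap.adjoint_inner_right, inner_self_eq_norm_sq_to_K]
    simp
  choose! c hc using hroot
  have hanti : ∀ d ∈ D, ∀ d' ∈ D, d ≤ d' → ∀ k, ‖σ (c d') k‖ ≤ ‖σ (c d) k‖ := by
    intro d hd d' hd' hdd k
    have h1 := sub_le_sub_left (hmono k hdd) (inner ℂ k (σ a k))
    simp only [hc d hd, hc d' hd'] at h1
    exact (sq_le_sq₀ (norm_nonneg _) (norm_nonneg _)).mp (Complex.real_le_real.mp h1)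
  let V : Submodule ℂ H :=
    { carrier := {k | ∀ ε : ℝ, 0 < ε → ∃ d ∈ D, ‖σ (c d) k‖ < ε}
      zero_mem' := fun ε hε => hDne.imp fun d hd => ⟨hd, by simpa using hε⟩
      add_mem' := by
        intro x y hx hy ε hε
        obtain ⟨d₁, hd₁, h₁⟩ := hx (ε / 2) (half_pos hε)
        obtain ⟨d₂, hd₂, h₂⟩ := hy (ε / 2) (half_pos hε)
        obtain ⟨d, hd, h1d, h2d⟩ := hDdir d₁ hd₁ d₂ hd₂
        refine ⟨d, hd, ?_⟩
        rw [map_add]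
        linarith [norm_add_le (σ (c d) x) (σ (c d) y), hanti d₁ hd₁ d hd h1d x,
          hanti d₂ hd₂ d hd h2d y]
      smul_mem' := by
        intro z x hx ε hε
        obtain ⟨d, hd, h⟩ := hx (ε / (‖z‖ + 1)) (by positivity)
        refine ⟨d, hd, ?_⟩
        rw [map_smul, norm_smul]
        rw [lt_div_iff₀ (by positivity)] at h
        nlinarith [norm_nonneg (σ (c d) x)] }
  have hV : IsClosed (V : Set H) := by
    refine isClosed_of_closure_subset fun x hx ε hε => ?_
    obtain ⟨d₀, hd₀⟩ := hDne
    obtain ⟨y, hy, hxy⟩ := Metric.mem_closure_iff.mp hx (ε / 2 / (‖σ (c d₀)‖ + 1)) (by positivity)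
    obtain ⟨d₁, hd₁, h₁⟩ := hy (ε / 2) (half_pos hε)
    obtain ⟨d, hd, h0d, h1d⟩ := hDdir d₀ hd₀ d₁ hd₁
    refine ⟨d, hd, ?_⟩
    rw [dist_eq_norm, lt_div_iff₀ (by positivity)] at hxy
    have h2 : ‖σ (c d) (x - y)‖ ≤ ‖σ (c d₀)‖ * ‖x - y‖ :=
      (hanti d₀ hd₀ d hd h0d _).trans (ContinuousLinearMap.le_opNorm _ _)
    have h3 := norm_add_le (σ (c d) (x - y)) (σ (c d) y)
    rw [← map_add, sub_add_cancel] at h3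
    nlinarith [hanti d₁ hd₁ d hd h1d y, norm_nonneg (x - y)]
  have hsV : s ⊆ V := by
    intro k hk ε hε
    obtain ⟨d, hd, hlt⟩ :=
      (isLUB_image_iff_approx (hmono k) hDne ha).mp (hn k hk D hDsa hDne hDdir a ha) (ε ^ 2)
        (by positivity)
    refine ⟨d, hd, lt_of_pow_lt_pow_left₀ 2 hε.le ?_⟩
    simp only [hc d hd, Complex.norm_real] at hlt
    rwa [Real.norm_of_nonneg (sq_nonneg _)] at hlt
  have hh : h ∈ V := by
    have := Submodule.topologicalClosure_minimal _ (Submodule.span_le.mpr hsV) hV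
    rw [hs] at this
    exact this trivial
  intro ε hε
  obtain ⟨d, hd, hlt⟩ := hh (√ε) (Real.sqrt_pos.mpr hε)
  refine ⟨d, hd, ?_⟩
  simp only [hc d hd, Complex.norm_real]
  rw [Real.norm_of_nonneg (sq_nonneg _)]
  exact (Real.lt_sqrt (norm_nonneg _)).mp hlt

end Normality

/-! ### The dilation -/

namespace PreProductSystem.Representation

variable {M : Type} [AddCommMonoid M] {A : Type u} [CStarAlgebra A] [PartialOrder A]
  [StarOrderedRing A] {X : PreProductSystem.{u, v} M A}
  {H : Type w} [NormedAddCommGroup H] [InnerProductSpace ℂ H] [CompleteSpace H]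
  {R : X.Representation H}

/-- The limit `K` of the isometries `1 ⊗ W_t`, on which the creation operators act. -/
lemma exists_limit_creation [PartialOrder M] [CanonicallyOrderedAdd M] [IsLeftCancelAdd M]
    (hR : R.IsFullyCoisometric) (hσ : R.σ 1 = 1) :
    ∃ (K : Type (max v w)) (_ : NormedAddCommGroup K) (_ : InnerProductSpace ℂ K)
      (_ : CompleteSpace K) (j : ∀ s, (X.fiber s).InteriorTensor R.σ →ₗᵢ[ℂ] K)
      (V : ∀ s, X.fiber s →ₗ[ℂ] (K →L[ℂ] K)),
      (∀ {s t r : M} (e : s + t = r) ζ, j r (incl hR e ζ) = j s ζ) ∧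
      DenseRange (fun p : Σ s, (X.fiber s).InteriorTensor R.σ => j p.1 p.2) ∧
      ∀ {s t r : M} (e : s + t = r) x ζ, V s x (j t ζ) = j r (X.creation R.σ e x ζ) := by
  let f : ∀ s r : M, s ≤ r →
      (X.fiber s).InteriorTensor R.σ →ₗᵢ[ℂ] (X.fiber r).InteriorTensor R.σ :=
    fun s r h => incl hR (exists_add_of_le h).choose_spec.symm
  -- By cancellation, `t` is determined by `s` and `s + t`.
  have hf : ∀ {s t r : M} (e : s + t = r) (h : s ≤ r), f s r h = incl hR e := by
    intro s t r e h
    obtain rfl : t = (exists_add_of_le h).choose :=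
      add_left_cancel (e.trans (exists_add_of_le h).choose_spec)
    rfl
  have hle : ∀ {s t r : M}, s + t = r → s ≤ r := fun e => e ▸ le_self_add
  have : IsDirectedOrder M := ⟨fun s t => ⟨s + t, le_self_add, le_add_self⟩⟩
  have : DirectedSystem (fun s => (X.fiber s).InteriorTensor R.σ) (f · · ·) :=
    { map_self := fun s ζ => by
        rw [hf (add_zero s) le_rfl]
        exact incl_zero hR hσ _ ζ
      map_map := fun r q s h₁ h₂ ζ => by
        obtain ⟨a, rfl⟩ := exists_add_of_le h₁
        obtain ⟨b, rfl⟩ := exists_add_of_le h₂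
        rw [hf rfl h₁, hf rfl h₂, hf (add_assoc _ a b).symm (h₁.trans h₂)]
        exact incl_incl hR _ _ rfl _ ζ }
  obtain ⟨K, _, _, _, j, hj, hd⟩ := exists_hilbert_limit f
  have hj' : ∀ {s t r : M} (e : s + t = r) ζ, j r (incl hR e ζ) = j s ζ := fun e ζ => by
    rw [← hf e (hle e)]
    exact hj _ _ (hle e) ζ
  have hd' : DenseRange (fun p : Σ s, (X.fiber s).InteriorTensor R.σ => j p.1 p.2) := by
    refine hd.mono (Set.iUnion_subset fun s => ?_)
    rintro _ ⟨ζ, rfl⟩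
    exact ⟨⟨s, ζ⟩, rfl⟩
  have hV : ∀ (s : M) (x : X.fiber s), ∃ Φ : K →L[ℂ] K, ∀ t ζ,
      Φ (j t ζ) = j (s + t) (X.creation R.σ rfl x ζ) := by
    intro s x
    refine exists_hilbert_limit_lift hj hd (C := ‖x‖)
      (fun t => (j (s + t)).toLinearMap ∘ₗ (X.creation R.σ rfl x).toLinearMap) ?_ ?_
    · intro t r h ζ
      obtain ⟨a, rfl⟩ := exists_add_of_le h
      rw [hf rfl h]
      exact (congrArg (j _) (incl_creation hR rfl (add_assoc s t a) rfl rfl x ζ)).symm.trans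
        (hj' _ _)
    · intro t ζ
      exact ((j _).norm_map _).le.trans (X.norm_creation_le R.σ rfl x ζ)
  choose V hV using hV
  have hext : ∀ {f g : K →L[ℂ] K}, (∀ t ζ, f (j t ζ) = g (j t ζ)) → f = g := fun {f g} h =>
    DFunLike.coe_injective (hd'.equalizer f.continuous g.continuous (funext fun p => h p.1 p.2))
  refine ⟨K, inferInstance, inferInstance, inferInstance, j, fun s =>
    { toFun := V s
      map_add' := fun x y => hext fun t ζ => by simp [hV, creation_add]
      map_smul' := fun c x => hext fun t ζ => by simp [hV, creation_smul] }, hj', hd', ?_⟩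
  rintro s t _ rfl x ζ
  exact hV s x t ζ

/-- The dilation theorem over any cancellative monoid in which `s ≤ t` means that `t - s` exists. The
surjectivity of `X(s) ⊗ X(t) → X(s + t)` enters only through `HasDenseProducts`, and only for the full
coisometry of the dilation, so that the `C*` and the `W*` case are treated together. -/
theorem exists_minimalDilation [PartialOrder M] [CanonicallyOrderedAdd M] [IsLeftCancelAdd M]
    (hR : R.IsFullyCoisometric) (hσ : R.σ 1 = 1) (hX : X.HasDenseProducts R.σ) :
    ∃ (K : Type (max v w)) (_ : NormedAddCommGroup K) (_ : InnerProductSpace ℂ K)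
      (_ : CompleteSpace K) (J : H →ₗᵢ[ℂ] K) (V : X.Representation K),
      V.IsIsometric ∧ V.IsFullyCoisometric ∧ V.σ 1 = 1 ∧ R.IsMinimalDilation V J := by
  obtain ⟨K, _, _, _, j, V, hj, hd, hV⟩ := exists_limit_creation hR hσ
  have hext : ∀ {f g : K →L[ℂ] K}, (∀ t ζ, f (j t ζ) = g (j t ζ)) → f = g := fun {f g} h =>
    DFunLike.coe_injective (hd.equalizer f.continuous g.continuous (funext fun p => h p.1 p.2))
  have hmul : ∀ {s t r : M} (e : s + t = r) (x : X.fiber s) (y : X.fiber t),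
      V r (X.mul e x y) = V s x * V t y := fun {s t r} e x y => hext fun q ζ => by
    have e' : s + (t + q) = r + q := by rw [← e, add_assoc]
    rw [mul_apply_eq_comp, hV rfl y ζ, hV e' x, hV rfl (X.mul e x y) ζ,
      X.creation_mul R.σ e rfl rfl e']
    rfl
  have hone : V 0 (X.unit 1) = 1 := hext fun t ζ => by
    rw [hV (zero_add t), creation_unit_one]
    rfl
  -- Any two vectors of the union come from a common index, where the identity is that of the
  -- creation operators.
  have hinner : ∀ {s : M} (x y : X.fiber s) (k l : K),
      inner ℂ (V s x k) (V s y l) = inner ℂ k (V 0 (X.unit ((X.fiber s).ip x y)) l) := by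
    intro s x y k l
    refine hd.induction_on₂ (p := fun k l => inner ℂ (V s x k) (V s y l) =
      inner ℂ k (V 0 (X.unit ((X.fiber s).ip x y)) l)) ?_ ?_ k l
    · exact isClosed_eq (by fun_prop) (by fun_prop)
    · rintro ⟨t, ζ⟩ ⟨t', ζ'⟩
      dsimp only
      rw [← hj (rfl : t + t' = t + t') ζ, ← hj (add_comm t' t) ζ', hV rfl, hV rfl,
        hV (zero_add (t + t')), (j _).inner_map_map, (j _).inner_map_map,
        inner_creation_creation]
  let ρ : A →⋆ₙₐ[ℂ] (K →L[ℂ] K) :=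
    { toFun := fun a => V 0 (X.unit a)
      map_smul' := fun c a => by simp
      map_zero' := by simp
      map_add' := fun a b => by simp
      map_mul' := fun a b => by
        rw [← hmul (zero_add 0), X.unit_mul, X.unit_mul_left]
      map_star' := fun a => by
        rw [ContinuousLinearMap.star_eq_adjoint, ContinuousLinearMap.eq_adjoint_iff]
        intro k l
        have h := hinner (X.unit (star a)) (X.unit 1) k l
        rwa [hone, X.ip_unit, star_star, mul_one] at h }
  have hρ : ∀ a, ρ a = V 0 (X.unit a) := fun a => rfl
  have hiso : ∀ s, CStarCorr.IsIsometricRep ρ (V s) := fun s x y => by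
    ext1 l
    refine ext_inner_left ℂ fun k => ?_
    rw [ContinuousLinearMap.star_eq_adjoint, mul_apply_eq_comp,
      ContinuousLinearMap.adjoint_inner_right, hinner, hρ]
  have hρ1 : ρ 1 = 1 := hone
  let 𝒱 : X.Representation K :=
    { σ := ρ
      T := V
      isCovariantRep := fun s =>
        { completelyBounded := (hiso s).isCompletelyBounded
          nondegenerate := by
            rw [eq_top_iff]
            exact fun k _ => Submodule.le_topologicalClosure _
              (Submodule.subset_span ⟨1, k, by rw [hρ1, one_apply_eq_self]⟩)
          map_op_smul := fun x a => by rw [← X.mul_unit (add_zero s), hmul, hρ]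
          map_smul := fun a x => by rw [← X.unit_mul (zero_add s), hmul, hρ] }
      T_unit := fun a => rfl
      map_mul := hmul }
  let J : H →ₗᵢ[ℂ] K := (j 0).comp ⟨(coext hR 0).toLinearMap, norm_coext hR⟩
  have hJ : ∀ s h, J h = j s (coext hR s h) := fun s h => by
    rw [← incl_coext hR (zero_add s), hj]
    rfl
  -- `P_H` restricts to `T̃_s` on `X(s) ⊗_σ H`.
  have hJadj : ∀ s ζ,
      ContinuousLinearMap.adjoint J.toContinuousLinearMap (j s ζ) = coiso hR s ζ := by
    intro s ζ
    refine ext_inner_left ℂ fun h => ?_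
    rw [ContinuousLinearMap.adjoint_inner_right, LinearIsometry.coe_toContinuousLinearMap, hJ s,
      (j s).inner_map_map, inner_coext_left]
  have hPV : ∀ s (x : X.fiber s) (k : K),
      ContinuousLinearMap.adjoint J.toContinuousLinearMap (V s x k) =
        R.T s x (ContinuousLinearMap.adjoint J.toContinuousLinearMap k) := by
    intro s x k
    refine hd.induction_on (p := fun k => ContinuousLinearMap.adjoint J.toContinuousLinearMap
      (V s x k) = R.T s x (ContinuousLinearMap.adjoint J.toContinuousLinearMap k)) k ?_ ?_
    · exact isClosed_eq (by fun_prop) (by fun_prop)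
    · rintro ⟨t, ζ⟩
      rw [hV rfl, hJadj, hJadj, coiso_creation]
  have hJJ : ∀ h, ContinuousLinearMap.adjoint J.toContinuousLinearMap (J h) = h := fun h => by
    rw [hJ 0, hJadj, coiso_coext]
  have hρJ : ∀ a h, ρ a (J h) = J (R.σ a h) := fun a h => by
    rw [hρ, hJ 0, hV (zero_add 0), creation_unit_coext, hJ 0]
  have hVJ : ∀ s (x : X.fiber s) h, V s x (J h) = j s ((X.fiber s).tmul R.σ x h) := by
    intro s x h
    rw [hJ 0, hV (add_zero s), coext_zero hR hσ, creation_tmul, X.mul_unit,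
      MulOpposite.op_one, one_smul]
  have hspan : ∀ (L : Submodule ℂ K), (∀ s ζ, j s ζ ∈ L.topologicalClosure) →
      L.topologicalClosure = ⊤ := by
    intro L hL
    rw [eq_top_iff]
    refine fun k _ => hd.induction_on (p := (· ∈ L.topologicalClosure)) k
      (Submodule.isClosed_topologicalClosure L) fun p => hL p.1 p.2
  have hmap : ∀ (L : Submodule ℂ K) {s : M} (S : Set ((X.fiber s).InteriorTensor R.σ)),
      (Submodule.span ℂ S).topologicalClosure = ⊤ → (∀ ζ ∈ S, j s ζ ∈ L) →
      ∀ ζ, j s ζ ∈ L.topologicalClosure := by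
    intro L s S hS hSL ζ
    have h1 : Submodule.span ℂ S ≤ L.topologicalClosure.comap (j s).toLinearMap :=
      Submodule.span_le.mpr fun ξ hξ => Submodule.le_topologicalClosure _ (hSL ξ hξ)
    have h2 := Submodule.topologicalClosure_minimal _ h1
      ((Submodule.isClosed_topologicalClosure L).preimage (j s).continuous)
    rw [hS] at h2
    exact h2 (Submodule.mem_top : ζ ∈ ⊤)
  refine ⟨K, inferInstance, inferInstance, inferInstance, J, 𝒱, hiso, fun s => ?_, hρ1, ?_⟩
  · refine (hiso s).isFullyCoisometricRep (hspan _ fun t ζ => ?_)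
    rw [← hj (add_comm t s) ζ]
    refine hmap _ _ (hX rfl) ?_ _
    rintro _ ⟨x, ξ, rfl⟩
    exact Submodule.subset_span ⟨x, j t ξ, hV rfl x ξ⟩
  · refine ⟨fun a => ?_, hρJ, fun s x h => ?_, fun s x k hk => ?_, hspan _ fun s =>
      hmap _ _ ((X.fiber s).span_tmul_dense R.σ) ?_⟩
    · ext1 k
      change J (ContinuousLinearMap.adjoint J.toContinuousLinearMap (V 0 (X.unit a) k)) =
        ρ a (J (ContinuousLinearMap.adjoint J.toContinuousLinearMap k))
      rw [hPV, hρJ, R.T_unit]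
    · change J (ContinuousLinearMap.adjoint J.toContinuousLinearMap (V s x (J h))) = _
      rw [hPV, hJJ]
    · change J (ContinuousLinearMap.adjoint J.toContinuousLinearMap (V s x k)) = 0
      have h0 : ContinuousLinearMap.adjoint J.toContinuousLinearMap k = 0 := by
        refine ext_inner_left ℂ fun h => ?_
        rw [ContinuousLinearMap.adjoint_inner_right, inner_zero_right]
        exact hk _ ⟨h, rfl⟩
      rw [hPV, h0, map_zero, map_zero]
    · rintro _ ⟨x, h, rfl⟩
      exact Submodule.subset_span ⟨s, x, h, hVJ s x h⟩

/-- On the vectors `V_s(x) h`, which span `K`, the functionals of `ρ` are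
`a ↦ ⟪h, σ(⟨x, a x⟩) h⟫`; they are normal because `σ` and the left action on `X(s)` are. -/
lemma IsMinimalDilation.isNormalRep {K : Type*} [NormedAddCommGroup K] [InnerProductSpace ℂ K]
    [CompleteSpace K] {V : X.Representation K} {J : H →ₗᵢ[ℂ] K} (h : R.IsMinimalDilation V J)
    (hV : V.IsIsometric) (hX : ∀ s, (X.fiber s).IsWStarCorr) (hR : IsNormalRep R.σ) :
    IsNormalRep V.σ := by
  refine isNormalRep_of_dense h.minimal ?_
  rintro _ ⟨s, x, g, rfl⟩
  have key : ∀ a : A, inner ℂ (V.T s x (J g)) (V.σ a (V.T s x (J g))) =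
      inner ℂ g (R.σ ((X.fiber s).ip x (a • x)) g) := by
    intro a
    rw [← mul_apply_eq_comp, ← (V.isCovariantRep s).map_smul,
      ← ContinuousLinearMap.adjoint_inner_right, ← mul_apply_eq_comp,
      ← ContinuousLinearMap.star_eq_adjoint, hV s, h.extend, J.inner_map_map]
  simp only [key]
  exact (hX s).2 x _ (isNormalPositiveFunctional_vector hR g)

end PreProductSystem.Representation

theorem mainTheorem5 {k : ℕ} (S : AddSubmonoid (Fin k → ℝ))
    (hS_nonneg : ∀ s ∈ S, 0 ≤ s)
    (hS : ∀ r ∈ AddSubgroup.closure (S : Set (Fin k → ℝ)), r⁺ ∈ S ∧ r⁻ ∈ S)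
    {A : Type u} [CStarAlgebra A] [PartialOrder A] [StarOrderedRing A]
    (X : PreProductSystem.{u, v} S A)
    {H : Type w} [NormedAddCommGroup H] [InnerProductSpace ℂ H] [CompleteSpace H]
    (R : X.Representation H) (hR : R.IsFullyCoisometric) (hσ : R.σ 1 = 1) :
    (X.IsProductSystem →
      ∃ (K : Type (max v w)) (_ : NormedAddCommGroup K) (_ : InnerProductSpace ℂ K)
        (_ : CompleteSpace K) (J : H →ₗᵢ[ℂ] K) (V : X.Representation K),
        V.IsIsometric ∧ V.IsFullyCoisometric ∧ V.σ 1 = 1 ∧ R.IsMinimalDilation V J) ∧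
    (WStarAlgebra A → X.IsWStarProductSystem → IsNormalRep R.σ →
      ∃ (K : Type (max v w)) (_ : NormedAddCommGroup K) (_ : InnerProductSpace ℂ K)
        (_ : CompleteSpace K) (J : H →ₗᵢ[ℂ] K) (V : X.Representation K),
        V.IsIsometric ∧ V.IsFullyCoisometric ∧ V.σ 1 = 1 ∧ R.IsMinimalDilation V J ∧
          IsNormalRep V.σ) := by
  -- If `s ≤ t` in `S`, then `t - s` is its own positive part, so it belongs to `S`.
  have : CanonicallyOrderedAdd S :=
    { exists_add_of_le := fun {s t} hst => by
        have hmem : (t : Fin k → ℝ) - s ∈ AddSubgroup.closure (S : Set (Fin k → ℝ)) :=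
          sub_mem (AddSubgroup.subset_closure t.2) (AddSubgroup.subset_closure s.2)
        have hpos := (hS _ hmem).1
        rw [posPart_of_nonneg (sub_nonneg.mpr (show (s : Fin k → ℝ) ≤ t from hst))] at hpos
        exact ⟨⟨_, hpos⟩, Subtype.ext (add_sub_cancel (s : Fin k → ℝ) t).symm⟩
      le_self_add := fun s t => show (s : Fin k → ℝ) ≤ s + t from
        le_add_of_nonneg_right (hS_nonneg t t.2)
      le_add_self := fun s t => show (s : Fin k → ℝ) ≤ t + s from
        le_add_of_nonneg_left (hS_nonneg t t.2) }
  refine ⟨fun hX => PreProductSystem.Representation.exists_minimalDilation hR hσ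
    (hX.hasDenseProducts R.σ), fun _ hX hn => ?_⟩
  obtain ⟨K, i₁, i₂, i₃, J, V, hiso, hco, h1, hmin⟩ :=
    PreProductSystem.Representation.exists_minimalDilation hR hσ (hX.hasDenseProducts hn)
  exact ⟨K, i₁, i₂, i₃, J, V, hiso, hco, h1, hmin, hmin.isNormalRep hiso hX.1 hn⟩
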